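/- \textbf{Setting.} A finite semi-Markov decision process (SMDP) has finite non-empty sets $\mathcal S$ of states and $\mathcal O$ of options and, for every $(s,o)\in\mathcal S\times\mathcal O$, a (discrete) probability distribution $\hat p(s',r,l\mid s,o)$ of the next state $s'\in\mathcal S$, the cumulative reward $r\in\mathbb R$ and the duration $l\in\{1,2,\dots\}$, with finite expected reward $\sum \hat p\,|r|$ and finite expected duration $\sum \hat p\,l$. In particular, let a finite MDP $p(s',r\mid s,a)$ be given together with finitely many options $o$, each consisting of a policy $\pi(a\mid s,o)$ and termination probabilities $\beta(s,o)\in[0,1]$, such that every option, wherever initiated, terminates with positive probability after at most $|\mathcal S|$ stages. These result in the SMDP given recursively by $\hat p(\cdot,\cdot,0\mid\cdot,\cdot)=0$ and, for $l\ge1$, $$\hat p(s',r,l\mid s,o)=\sum_a\pi(a\mid s,o)\sum_{\tilde s,\tilde r}p(\tilde s,\tilde r\mid s,a)\big[\beta(\tilde s,o)\mathbf 1\{\tilde s=s',\tilde r=r,l=1\}+(1-\beta(\tilde s,o))\,\hat p(s',r-\tilde r,l-1\mid\tilde s,o)\big].$$ A policy is a stationary Markov (randomized) policy $\pi(o\mid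 s)$; $P_\pi(s,s')=\sum_{o,r,l}\pi(o\mid s)\hat p(s',r,l\mid s,o)$. A set $C\subseteq\mathcal S$ is \emph{communicating} if for some policy $\pi$ every state of $C$ is reached from every state of $C$ in finitely many steps of the chain $P_\pi$ with positive probability, and \emph{closed} if no option leads out of $C$ with positive probability. The SMDP is \emph{communicating} if $\mathcal S$ is a communicating set, and \emph{weakly communicating} if there is a non-empty closed communicating set $C$ such that all states outside $C$ are transient under every policy. The reward rate of $\pi$ from $s$ is $r(\pi,s)=\lim_{n\to\infty}\mathbb E_\pi[\sum_{i<n}\hat R_i\mid \hat S_0=s]\,/\,\mathbb E_\pi[\sum_{i<n}\hat L_i\mid \hat S_0=s]$, where $\hat R_i,\hat L_i$ are the reward and the duration of the $i$-th option executed, and $\hat r_*=\sup_\pi r(\pi,s)$ is the optimal reward rate. Let $f:\mathbb R^{\mathcal S\times\mathcal O}\to\mathbb R$ be Lipschitz, with $f(cx)=cf(x)$ for all $c\in\mathbb R$ and all $x$, and such that for some $u>0$, with $e$ the all-one vector, $f(e)=u$ and $f(x+ce)=f(x)+cu$ for all $x$ and all $c\in\mathbb R$. Let $\mathcal Q_\infty$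 be the set of all $q\in\mathbb R^{\mathcal S\times\mathcal O}$ with $f(q)=\hat r_*$ that solve, for some $\bar r\in\mathbb R$, the SMDP optimality equation $$q(s,o)=\sum_{s',r,l}\hat p(s',r,l\mid s,o)\Big(r-\bar r\,l+\max_{o'}q(s',o')\Big)\qquad\text{for all } s\in\mathcal S,\ o\in\mathcal O.$$ \textbf{Theorem.} If the SMDP is weakly communicating and $f$ is as above, then $\hat r_*$ exists and does not depend on the start state $s$, and $\mathcal Q_\infty$ is non-empty, closed, bounded and connected. This holds in particular for the SMDPs that result from an MDP and options as above. $\mathcal Q_\infty$ need not be convex: consider the deterministic communicating MDP with states $1,2,3$ and actions \texttt{solid}, \texttt{dashed}, in which \texttt{solid} leads $1\to1$, $2\to2$, $3\to2$ and \texttt{dashed} leads $1\to2$, $2\to3$, $3\to1$, with reward $-2$ for \texttt{dashed} in $1$, reward $-1$ for \texttt{solid} in $3$, and reward $0$ otherwise, every action being executed as an option that lasts one step; let $f(q)=\sum_{s,a}q(s,a)$. This $f$ is as above, the SMDP is weakly communicating, $\hat r_*=0$, and $\mathcal Q_\infty$ is not convex. -/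

import Mathlib

open Filter Topology

noncomputable section

/-- The law of one decision epoch of a semi-Markov decision process with state space `S` and option
(action) space `O`: `K s o s' r l` is the probability `p̂ (s', r, l ∣ s, o)` that the option `o`,
started in the state `s`, ends in the state `s'` with cumulative reward `r` after `l` time steps. -/
abbrev SMDPKernel (S O : Type*) := S → O → S → ℝ → ℕ → ℝ

/-- A semi-Markov decision process with discrete rewards and positive integer durations: for all
`s`, `o`, the kernel is a probability distribution on triples `(s', r, l)` with `l ≥ 1`, and the
expected reward and the expected duration are finite. -/
structure IsSMDP {S O : Type*} (K : SMDPKernel S O) : Prop where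
  nonneg : ∀ s o s' r l, 0 ≤ K s o s' r l
  hasSum_one : ∀ s o, HasSum (fun x : S × ℝ × ℕ => K s o x.1 x.2.1 x.2.2) 1
  length_pos : ∀ s o s' r, K s o s' r 0 = 0
  summable_reward : ∀ s o, Summable (fun x : S × ℝ × ℕ => K s o x.1 x.2.1 x.2.2 * |x.2.1|)
  summable_length : ∀ s o, Summable (fun x : S × ℝ × ℕ => K s o x.1 x.2.1 x.2.2 * (x.2.2 : ℝ))

/-- A stationary Markov (randomized) policy: `prob s o` is the probability of choosing `o`
in the state `s`. -/
structure StationaryPolicy (S O : Type*) [Fintype O] where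
  prob : S → O → ℝ
  prob_nonneg : ∀ s o, 0 ≤ prob s o
  prob_sum : ∀ s, ∑ o, prob s o = 1

namespace SMDPKernel

variable {S O : Type*}

/-- The transition probability `∑_{r, l} p̂ (s', r, l ∣ s, o)` of the embedded MDP. -/
def trans (K : SMDPKernel S O) (s : S) (o : O) (s' : S) : ℝ :=
  ∑' y : ℝ × ℕ, K s o s' y.1 y.2

/-- The expected cumulative reward of `o` started in `s`. -/
def meanReward (K : SMDPKernel S O) (s : S) (o : O) : ℝ :=
  ∑' x : S × ℝ × ℕ, K s o x.1 x.2.1 x.2.2 * x.2.1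

/-- The expected duration of `o` started in `s`. -/
def meanLength (K : SMDPKernel S O) (s : S) (o : O) : ℝ :=
  ∑' x : S × ℝ × ℕ, K s o x.1 x.2.1 x.2.2 * (x.2.2 : ℝ)

/-- The transition matrix of the embedded Markov chain of states under a stationary policy. -/
def policyMatrix [Fintype O] (K : SMDPKernel S O) (π : StationaryPolicy S O) : Matrix S S ℝ :=
  Matrix.of fun s s' => ∑ o, π.prob s o * K.trans s o s'

/-- The expected reward of one decision epoch under a stationary policy. -/
def policyReward [Fintype O] (K : SMDPKernel S O) (π : StationaryPolicy S O) : S → ℝ :=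
  fun s => ∑ o, π.prob s o * K.meanReward s o

/-- The expected duration of one decision epoch under a stationary policy. -/
def policyLength [Fintype O] (K : SMDPKernel S O) (π : StationaryPolicy S O) : S → ℝ :=
  fun s => ∑ o, π.prob s o * K.meanLength s o

variable [Fintype S] [DecidableEq S] [Fintype O]

/-- The set `C` is communicating: under some policy every state of `C` is reached from every state
of `C` in finitely many steps with positive probability. -/
def IsCommunicatingSet (K : SMDPKernel S O) (C : Set S) : Prop :=
  ∃ π : StationaryPolicy S O, ∀ s ∈ C, ∀ s' ∈ C, ∃ n : ℕ, 0 < (K.policyMatrix π ^ n) s s'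

/-- The set `C` is closed: no option leads out of it. -/
def IsClosedSet (K : SMDPKernel S O) (C : Set S) : Prop :=
  ∀ s ∈ C, ∀ o, ∀ s', 0 < K.trans s o s' → s' ∈ C

/-- The state `s` is transient under `π`: the expected number of visits to `s` of the
embedded chain started in `s` is finite. -/
def IsTransientState (K : SMDPKernel S O) (π : StationaryPolicy S O) (s : S) : Prop :=
  Summable fun n : ℕ => (K.policyMatrix π ^ n) s s

/-- Weakly communicating: a closed communicating set of states, and a possibly empty set of
states that are transient under every policy. -/
def WeaklyCommunicating (K : SMDPKernel S O) : Prop :=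
  ∃ C : Set S, C.Nonempty ∧ K.IsClosedSet C ∧ K.IsCommunicatingSet C ∧
    ∀ s ∉ C, ∀ π : StationaryPolicy S O, K.IsTransientState π s

/-- `E_π [∑_{i < n} R̂_i ∣ Ŝ_0 = s]`, the expected total reward of the first `n` epochs. -/
def totalReward (K : SMDPKernel S O) (π : StationaryPolicy S O) (n : ℕ) (s : S) : ℝ :=
  ∑ i ∈ Finset.range n, ((K.policyMatrix π ^ i).mulVec (K.policyReward π)) s

/-- `E_π [∑_{i < n} L̂_i ∣ Ŝ_0 = s]`, the expected total duration of the first `n` epochs. -/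
def totalLength (K : SMDPKernel S O) (π : StationaryPolicy S O) (n : ℕ) (s : S) : ℝ :=
  ∑ i ∈ Finset.range n, ((K.policyMatrix π ^ i).mulVec (K.policyLength π)) s

/-- `ρ` is the reward rate `r(π, s)` of the stationary policy `π` from the start state `s`. -/
def IsRewardRate (K : SMDPKernel S O) (π : StationaryPolicy S O) (s : S) (ρ : ℝ) : Prop :=
  Tendsto (fun n : ℕ => K.totalReward π n s / K.totalLength π n s) atTop (𝓝 ρ)

/-- `ρ` is the optimal reward rate: from every start state, it is the supremum of the reward rates
of the stationary policies. -/
def IsOptimalRate (K : SMDPKernel S O) (ρ : ℝ) : Prop :=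
  ∀ s : S, IsLUB {x : ℝ | ∃ π : StationaryPolicy S O, K.IsRewardRate π s x} ρ

/-- The SMDP optimality equation
`q(s, o) = ∑_{s', r, l} p̂ (s', r, l ∣ s, o) (r - r̄ l + max_{o'} q(s', o'))` for all `s`, `o`. -/
def OptimalityEquation [Nonempty O] (K : SMDPKernel S O) (rbar : ℝ) (q : S × O → ℝ) : Prop :=
  ∀ s o, q (s, o) = ∑' x : S × ℝ × ℕ, K s o x.1 x.2.1 x.2.2 *
    (x.2.1 - rbar * (x.2.2 : ℝ) +
      Finset.univ.sup' Finset.univ_nonempty (fun o' => q (x.1, o')))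

/-- The set of the solutions `q` of the optimality equation (whose unknowns are `r̄` and `q`) that
satisfy `f(q) = ρ`; with `ρ` the optimal reward rate this is `𝒬_∞`. -/
def solutionSet [Nonempty O] (K : SMDPKernel S O) (f : (S × O → ℝ) → ℝ) (ρ : ℝ) :
    Set (S × O → ℝ) :=
  {q | (∃ rbar : ℝ, K.OptimalityEquation rbar q) ∧ f q = ρ}

end SMDPKernel

/-- The assumption on `f`: Lipschitz, equivariant under shifts along the all-one vector `e` with
`f(e) = u > 0`, and homogeneous. -/
structure IsAdmissibleFunctional {ι : Type*} [Fintype ι] (f : (ι → ℝ) → ℝ) : Prop where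
  lipschitz : ∃ L, LipschitzWith L f
  shift : ∃ u : ℝ, 0 < u ∧ f (fun _ => 1) = u ∧
    ∀ (x : ι → ℝ) (c : ℝ), f (x + c • (fun _ => (1 : ℝ))) = f x + c * u
  homogeneous : ∀ (c : ℝ) (x : ι → ℝ), f (c • x) = c * f x

/-- A finite MDP: a finite set of rewards and the dynamics `p s' r s a = p(s', r ∣ s, a)`. -/
structure FiniteMDP (S A : Type*) [Fintype S] where
  rewards : Finset ℝ
  p : S → rewards → S → A → ℝ
  p_nonneg : ∀ s' r s a, 0 ≤ p s' r s a
  p_sum : ∀ s a, ∑ s' : S, ∑ r : rewards, p s' r s a = 1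

/-- An option: a policy `pol a s = π(a ∣ s)` and a termination probability in every state. -/
structure MDPOption (S A : Type*) [Fintype A] where
  pol : A → S → ℝ
  pol_nonneg : ∀ a s, 0 ≤ pol a s
  pol_sum : ∀ s, ∑ a, pol a s = 1
  term : S → ℝ
  term_nonneg : ∀ s, 0 ≤ term s
  term_le_one : ∀ s, term s ≤ 1

namespace FiniteMDP

variable {S A O : Type*} [Fintype S] [DecidableEq S] [Fintype A]

open Classical in
/-- `M.optionLaw ω l s s' r` is the probability that the option `ω`, started in `s`, terminates
in `s'` with cumulative reward `r` and length `l`; defined by recursion on `l`. -/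
def optionLaw (M : FiniteMDP S A) (ω : MDPOption S A) : ℕ → S → S → ℝ → ℝ
  | 0, _, _, _ => 0
  | l + 1, s, s', r =>
      ∑ a, ω.pol a s * ∑ t : S, ∑ ρ : M.rewards, M.p t ρ s a *
        (ω.term t * (if t = s' ∧ (ρ : ℝ) = r ∧ l + 1 = 1 then 1 else 0) +
          (1 - ω.term t) * optionLaw M ω l t s' (r - (ρ : ℝ)))

/-- The SMDP that results from an MDP and a family of options. -/
def optionKernel (M : FiniteMDP S A) (opt : O → MDPOption S A) : SMDPKernel S O :=
  fun s o s' r l => M.optionLaw (opt o) l s s' r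

/-- Every option, whatever the state in which it is initiated, terminates with positive
probability after at most `|S|` stages. -/
def OptionsTerminate (M : FiniteMDP S A) (opt : O → MDPOption S A) : Prop :=
  ∀ o s, 0 < ∑ l ∈ Finset.range (Fintype.card S + 1), ∑ s' : S, ∑' r : ℝ,
    M.optionLaw (opt o) l s s' r

end FiniteMDP

/-- The primitive option of an action: take the action once, then terminate. -/
def primitiveOption {S A : Type*} [Fintype A] [DecidableEq A] (b : A) : MDPOption S A where
  pol a _ := if a = b then 1 else 0
  pol_nonneg a _ := by split_ifs <;> norm_num
  pol_sum _ := by simp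
  term _ := 1
  term_nonneg _ := zero_le_one
  term_le_one _ := le_rfl

/-- Next state in the three-state example; the states `1, 2, 3` are `0, 1, 2 : Fin 3`, the action
`solid` is `false` and the action `dashed` is `true`. -/
def exampleNext : Fin 3 → Bool → Fin 3
  | 0, false => 0
  | 0, true => 1
  | 1, false => 1
  | 1, true => 2
  | 2, false => 1
  | 2, true => 0

/-- Reward in the example: `-2` for `dashed` in state `1`, `-1` for `solid` in state `3`,
and `0` otherwise. -/
def exampleReward : Fin 3 → Bool → ℝ
  | 0, false => 0
  | 0, true => -2
  | 1, false => 0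
  | 1, true => 0
  | 2, false => -1
  | 2, true => 0

/-- The deterministic three-state MDP of the example. -/
def exampleMDP : FiniteMDP (Fin 3) Bool where
  rewards := {0, -1, -2}
  p s' r s a := if s' = exampleNext s a ∧ (r : ℝ) = exampleReward s a then 1 else 0
  p_nonneg _ _ _ _ := by split_ifs <;> norm_num
  p_sum s a := by
    have hmem : exampleReward s a ∈ ({0, -1, -2} : Finset ℝ) := by
      fin_cases s <;> cases a <;> simp [exampleReward, eq_comm]
    rw [Finset.sum_eq_single (exampleNext s a), Finset.sum_eq_single ⟨exampleReward s a, hmem⟩]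
    · simp
    · intro r _ hr
      have : (r : ℝ) ≠ exampleReward s a := fun h => hr (Subtype.ext h)
      simp [this]
    · exact fun h => absurd (Finset.mem_univ _) h
    · intro s' _ hs'
      simp [hs']
    · simp

/-- The example as an SMDP: every action is executed as a primitive option. -/
def exampleKernel : SMDPKernel (Fin 3) Bool :=
  exampleMDP.optionKernel primitiveOption

end

/-! Summing the kernel out leaves a finite model: transition probabilities `P`, mean rewards `R`,
mean lengths `τ ≥ 1`. For a fixed rate `g` the optimality equation says that `q` is a fixed point of
`q ↦ R - gτ + P max q`, an operator that is monotone, convex, nonexpansive in the sup norm, and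
commutes with adding constants.

Weak communication enters through one fact, `IsSMDP.eq_const_of_bellman_eq`: `h = P max h` has only
constant solutions. It yields compactness (`exists_norm_le_of_bellman_eq`): if solutions normalized
to vanish at a point were unbounded, rescaling them to norm one would produce in the limit a
nonconstant solution of the homogeneous equation. Compactness gives existence, as a limit of
discounted problems (`exists_bellman_eq`), and boundedness once `f` fixes the additive constant.

Telescoping the equation along the chain shows that its rate must be the optimal reward rate
(`IsSMDP.isOptimalRate`), so a single `g` accounts for the whole solution set. For that `g`, a
segment between two fixed points consists of points that the operator moves down; iterating the
operator pushes the segment onto a path of fixed points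
(`isPreconnected_fixedPoints_of_monotone_convex`). Adding the constant that makes `f(q)` equal to
the optimal rate maps the fixed points continuously onto the solution set, which is therefore
connected.

For options, uniform termination makes survival probabilities decay geometrically, whence finite
means. In the example, convexity fails at the kink of a maximum. -/

noncomputable section

/-! ### Fixed points of monotone convex nonexpansive maps -/

/-- The fixed point set of a monotone, convex, nonexpansive self-map of `ι → ℝ` is preconnected:
the iterates of the map, started on a segment between two fixed points, decrease to a continuous
curve of fixed points. -/
theorem isPreconnected_fixedPoints_of_monotone_convex {ι : Type*} [Fintype ι]
    {T : (ι → ℝ) → ι → ℝ} (hmono : Monotone T) (hlip : LipschitzWith 1 T)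
    (hconv : ∀ x y : ι → ℝ, ∀ t ∈ Set.Icc (0 : ℝ) 1,
      T ((1 - t) • x + t • y) ≤ (1 - t) • T x + t • T y) :
    IsPreconnected (Function.fixedPoints T) := by
  refine isPreconnected_of_forall_pair fun x hx y hy => ?_
  set c : ℝ → ι → ℝ := fun t => (1 - t) • x + t • y with hc
  -- Convexity compares `T (c t)` with the same combination of `T x = x` and `T y = y`, which is `c
  -- t` itself.
  have hcT : ∀ t ∈ Set.Icc (0 : ℝ) 1, T (c t) ≤ c t := fun t ht => by
    have := hconv x y t ht
    rwa [hx.eq, hy.eq] at this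
  have hanti : ∀ t ∈ Set.Icc (0 : ℝ) 1, Antitone fun n => T^[n] (c t) := fun t ht =>
    antitone_nat_of_succ_le fun n => by
      rw [Function.iterate_succ_apply]
      exact hmono.iterate n (hcT t ht)
  have hlipn : ∀ n, LipschitzWith 1 T^[n] := fun n => by simpa using hlip.iterate n
  -- The iterates stay within `dist (c t) x` of the fixed point `x`, so the decreasing sequence
  -- cannot escape to `-∞`.
  have hbdd : ∀ t, ∀ i, BddBelow (Set.range fun n => T^[n] (c t) i) := fun t i => by
    refine ⟨x i - dist (c t) x, ?_⟩
    rintro _ ⟨n, rfl⟩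
    have h1 := (hlipn n).dist_le_mul (c t) x
    rw [(hx.iterate n).eq] at h1
    have h2 := (dist_le_pi_dist (T^[n] (c t)) x i).trans h1
    rw [Real.dist_eq] at h2
    have := neg_abs_le (T^[n] (c t) i - x i)
    simp only [NNReal.coe_one, one_mul] at h2
    dsimp only
    linarith
  set φ : ℝ → ι → ℝ := fun t i => ⨅ n, T^[n] (c t) i with hφ
  have hlim : ∀ t ∈ Set.Icc (0 : ℝ) 1, Tendsto (fun n => T^[n] (c t)) atTop (𝓝 (φ t)) :=
    fun t ht => tendsto_pi_nhds.mpr fun i =>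
      tendsto_atTop_ciInf (fun m n hmn => hanti t ht hmn i) (hbdd t i)
  have hfix : ∀ t ∈ Set.Icc (0 : ℝ) 1, φ t ∈ Function.fixedPoints T := fun t ht =>
    isFixedPt_of_tendsto_iterate (hlim t ht) hlip.continuous.continuousAt
  -- All iterates share the Lipschitz constant 1, and it passes to the limit; an infimum of
  -- continuous functions alone would only be upper semicontinuous.
  have hdist : ∀ s ∈ Set.Icc (0 : ℝ) 1, ∀ t ∈ Set.Icc (0 : ℝ) 1,
      dist (φ s) (φ t) ≤ dist (c s) (c t) := fun s hs t ht =>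
    le_of_tendsto ((hlim s hs).dist (hlim t ht)) <| Eventually.of_forall fun n => by
      simpa using (hlipn n).dist_le_mul (c s) (c t)
  have hcc : Continuous c := by fun_prop
  have hφc : ContinuousOn φ (Set.Icc 0 1) := by
    intro s hs
    refine tendsto_iff_dist_tendsto_zero.mpr ?_
    have h0 : Tendsto (fun t => dist (c t) (c s)) (𝓝[Set.Icc 0 1] s) (𝓝 0) :=
      tendsto_iff_dist_tendsto_zero.mp (hcc.continuousWithinAt (s := Set.Icc 0 1))
    refine squeeze_zero' (Eventually.of_forall fun _ => dist_nonneg) ?_ h0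
    filter_upwards [self_mem_nhdsWithin] with t ht using hdist t ht s hs
  have hiter : ∀ z, Function.IsFixedPt T z → ∀ t ∈ Set.Icc (0 : ℝ) 1, c t = z → φ t = z :=
    fun z hz t ht h => by
      refine tendsto_nhds_unique (hlim t ht) ?_
      simp only [h, (hz.iterate _).eq]
      exact tendsto_const_nhds
  refine ⟨φ '' Set.Icc 0 1, ?_, ?_, ?_, isPreconnected_Icc.image φ hφc⟩
  · rintro _ ⟨t, ht, rfl⟩
    exact hfix t ht
  · exact ⟨0, by simp, hiter x hx 0 (by simp) (by simp [hc])⟩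
  · exact ⟨1, by simp, hiter y hy 1 (by simp) (by simp [hc])⟩

/-! ### The maximum over options and the Bellman operator -/

section Bellman

variable {S O : Type*} [Fintype O] [Nonempty O]

/-- The state value `max_o q(s, o)` of an action-value function. -/
def optionMax (q : S × O → ℝ) (s : S) : ℝ :=
  Finset.univ.sup' Finset.univ_nonempty fun o => q (s, o)

theorem le_optionMax (q : S × O → ℝ) (s : S) (o : O) : q (s, o) ≤ optionMax q s :=
  Finset.le_sup' (fun o => q (s, o)) (Finset.mem_univ o)

theorem optionMax_le {q : S × O → ℝ} {s : S} {c : ℝ} (h : ∀ o, q (s, o) ≤ c) :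
    optionMax q s ≤ c :=
  Finset.sup'_le _ _ fun o _ => h o

theorem exists_eq_optionMax (q : S × O → ℝ) (s : S) : ∃ o, optionMax q s = q (s, o) := by
  obtain ⟨o, -, ho⟩ := Finset.exists_mem_eq_sup' Finset.univ_nonempty fun o => q (s, o)
  exact ⟨o, ho⟩

theorem optionMax_mono {p q : S × O → ℝ} (h : p ≤ q) (s : S) : optionMax p s ≤ optionMax q s :=
  optionMax_le fun o => (h (s, o)).trans (le_optionMax q s o)

theorem optionMax_add_const (q : S × O → ℝ) (c : ℝ) (s : S) :
    optionMax (fun x => q x + c) s = optionMax q s + c := by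
  refine le_antisymm (optionMax_le fun o => by have := le_optionMax q s o; linarith) ?_
  obtain ⟨o, ho⟩ := exists_eq_optionMax q s
  rw [ho]
  exact le_optionMax (fun x => q x + c) s o

theorem optionMax_const (c : ℝ) (s : S) : optionMax (fun _ : S × O => c) s = c := by
  simp [optionMax]

theorem optionMax_smul {c : ℝ} (hc : 0 ≤ c) (q : S × O → ℝ) (s : S) :
    optionMax (c • q) s = c * optionMax q s := by
  refine le_antisymm
    (optionMax_le fun o => mul_le_mul_of_nonneg_left (le_optionMax q s o) hc) ?_
  obtain ⟨o, ho⟩ := exists_eq_optionMax q s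
  rw [ho]
  exact le_optionMax (c • q) s o

theorem optionMax_add_le (p q : S × O → ℝ) (s : S) :
    optionMax (p + q) s ≤ optionMax p s + optionMax q s :=
  optionMax_le fun o => add_le_add (le_optionMax p s o) (le_optionMax q s o)

variable [Fintype S]

theorem abs_optionMax_sub_le (p q : S × O → ℝ) (s : S) :
    |optionMax p s - optionMax q s| ≤ dist p q := by
  have key : ∀ p q : S × O → ℝ, optionMax p s ≤ optionMax q s + dist p q := fun p q =>
    optionMax_le fun o => by
      have h1 := dist_le_pi_dist p q (s, o)
      rw [Real.dist_eq] at h1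
      have h2 := le_abs_self (p (s, o) - q (s, o))
      have h3 := le_optionMax q s o
      linarith
  have h1 := key p q
  have h2 := key q p
  rw [dist_comm] at h2
  exact abs_le.mpr ⟨by linarith, by linarith⟩

theorem abs_optionMax_le (q : S × O → ℝ) (s : S) : |optionMax q s| ≤ ‖q‖ := by
  have h := abs_optionMax_sub_le q (fun _ => 0) s
  rw [optionMax_const, sub_zero] at h
  have h0 : dist q (fun _ => 0) = ‖q‖ := dist_zero_right q
  rwa [h0] at h

@[fun_prop]
theorem continuous_optionMax (s : S) : Continuous fun q : S × O → ℝ => optionMax q s :=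
  (LipschitzWith.of_dist_le_mul (K := 1) fun p q => by
    simpa [Real.dist_eq] using abs_optionMax_sub_le p q s).continuous

/-- The operator `q ↦ c(s, o) + ∑_{s'} W(s, o, s') max_{o'} q(s', o')`. -/
def bellman (W : S × O → S → ℝ) (c : S × O → ℝ) (q : S × O → ℝ) : S × O → ℝ :=
  fun x => c x + ∑ s', W x s' * optionMax q s'

theorem monotone_bellman {W : S × O → S → ℝ} (hW : ∀ x s', 0 ≤ W x s') (c : S × O → ℝ) :
    Monotone (bellman W c) := fun _ _ h x =>
  add_le_add le_rfl <|
    Finset.sum_le_sum fun s' _ => mul_le_mul_of_nonneg_left (optionMax_mono h s') (hW x s')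

/-- Serves twice: with `κ = 1` for the undiscounted operator and with `κ < 1` for the discounted
one, a contraction. -/
theorem lipschitzWith_bellman {W : S × O → S → ℝ} (hW : ∀ x s', 0 ≤ W x s') {κ : NNReal}
    (hκ : ∀ x, ∑ s', W x s' ≤ κ) (c : S × O → ℝ) : LipschitzWith κ (bellman W c) := by
  refine LipschitzWith.of_dist_le_mul fun p q => (dist_pi_le_iff (by positivity)).mpr fun x => ?_
  rw [Real.dist_eq]
  calc |bellman W c p x - bellman W c q x|
      = |∑ s', W x s' * (optionMax p s' - optionMax q s')| := by
        simp only [bellman, mul_sub, Finset.sum_sub_distrib]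
        congr 1
        ring
    _ ≤ ∑ s', W x s' * dist p q := by
        refine (Finset.abs_sum_le_sum_abs _ _).trans (Finset.sum_le_sum fun s' _ => ?_)
        rw [abs_mul, abs_of_nonneg (hW x s')]
        exact mul_le_mul_of_nonneg_left (abs_optionMax_sub_le p q s') (hW x s')
    _ ≤ κ * dist p q := by
        rw [← Finset.sum_mul]
        exact mul_le_mul_of_nonneg_right (hκ x) dist_nonneg

/-- The maximum is sublinear and the weights are nonnegative. -/
theorem bellman_convex {W : S × O → S → ℝ} (hW : ∀ x s', 0 ≤ W x s') (c p q : S × O → ℝ)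
    {t : ℝ} (ht : t ∈ Set.Icc (0 : ℝ) 1) :
    bellman W c ((1 - t) • p + t • q) ≤ (1 - t) • bellman W c p + t • bellman W c q := by
  intro x
  have h : ∀ s', W x s' * optionMax ((1 - t) • p + t • q) s' ≤
      (1 - t) * (W x s' * optionMax p s') + t * (W x s' * optionMax q s') := fun s' => by
    have h1 := optionMax_add_le ((1 - t) • p) (t • q) s'
    rw [optionMax_smul (by linarith [ht.2]), optionMax_smul ht.1] at h1
    have := mul_le_mul_of_nonneg_left h1 (hW x s')
    linarith
  have h2 := Finset.sum_le_sum fun s' (_ : s' ∈ Finset.univ) => h s'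
  rw [Finset.sum_add_distrib, ← Finset.mul_sum, ← Finset.mul_sum] at h2
  simp only [bellman, Pi.add_apply, Pi.smul_apply, smul_eq_mul]
  linarith

theorem bellman_add_const {W : S × O → S → ℝ} (hW : ∀ x, ∑ s', W x s' = 1)
    (c q : S × O → ℝ) (b : ℝ) :
    bellman W c (fun x => q x + b) = fun x => bellman W c q x + b := by
  funext x
  simp only [bellman, optionMax_add_const, mul_add, Finset.sum_add_distrib, ← Finset.sum_mul, hW]
  ring

/-! ### The optimality equation of a finite model -/

section Model

variable {P : S × O → S → ℝ} {R τ : S × O → ℝ}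

/-- If only constants solve the homogeneous equation, then the normalized solutions of the
perturbed optimality equations `h = R - gτ + (1 - aτ) P max h` are uniformly bounded. -/
theorem exists_norm_le_of_bellman_eq
    (hconst : ∀ h : S × O → ℝ, bellman P 0 h = h → ∀ x y, h x = h y) (x₀ : S × O) (G : ℝ) :
    ∃ a₀ > 0, ∃ B : ℝ, ∀ a ∈ Set.Icc 0 a₀, ∀ g : ℝ, |g| ≤ G → ∀ h : S × O → ℝ, h x₀ = 0 →
      bellman (fun x s' => (1 - a * τ x) * P x s') (fun x => R x - g * τ x) h = h → ‖h‖ ≤ B := by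
  by_contra! hcon
  -- Taking `1/(n+1)` for `a₀` and `n+1` for `B` forces `a n → 0` and `‖h n‖ → ∞` along the
  -- counterexamples.
  have hcon' := fun n : ℕ => hcon (1 / (n + 1)) Nat.one_div_pos_of_nat (n + 1)
  choose a ha g hg h hx₀ hh hn using hcon'
  have hpos : ∀ n, 0 < ‖h n‖ := fun n => lt_trans (by positivity) (hn n)
  set y : ℕ → S × O → ℝ := fun n => ‖h n‖⁻¹ • h n with hy
  have hysphere : ∀ n, y n ∈ Metric.sphere (0 : S × O → ℝ) 1 := fun n => by
    rw [mem_sphere_zero_iff_norm, hy]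
    simp only [norm_smul, norm_inv, norm_norm]
    exact inv_mul_cancel₀ (hpos n).ne'
  obtain ⟨z, hz, φ, hφ, hlim⟩ := (isCompact_sphere (0 : S × O → ℝ) 1).tendsto_subseq hysphere
  have ha0 : Tendsto a atTop (𝓝 0) :=
    squeeze_zero (fun n => (ha n).1) (fun n => (ha n).2) tendsto_one_div_add_atTop_nhds_zero_nat
  have hninv : Tendsto (fun n => ‖h n‖⁻¹) atTop (𝓝 0) := by
    refine squeeze_zero (fun n => by positivity) (fun n => ?_)
      tendsto_one_div_add_atTop_nhds_zero_nat
    rw [one_div]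
    exact inv_anti₀ (by positivity) (hn n).le
  have hgn : Tendsto (fun n => ‖h n‖⁻¹ * g n) atTop (𝓝 0) := by
    refine squeeze_zero_norm (a := fun n => ‖h n‖⁻¹ * G) (fun n => ?_) (by simpa using hninv.mul_const G)
    rw [Real.norm_eq_abs, abs_mul, abs_of_pos (inv_pos.mpr (hpos n))]
    exact mul_le_mul_of_nonneg_left (hg n) (inv_pos.mpr (hpos n)).le
  -- The maximum is positively homogeneous, so the equation can be divided by `‖h n‖`; the terms
  -- with `R` and the bounded `g` then vanish in the limit.
  have hyeq : ∀ n x, y n x = ‖h n‖⁻¹ * R x - ‖h n‖⁻¹ * g n * τ x +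
      ∑ s', (1 - a n * τ x) * P x s' * optionMax (y n) s' := fun n x => by
    have h1 := congrFun (hh n) x
    simp only [hy, Pi.smul_apply, smul_eq_mul, optionMax_smul (inv_pos.mpr (hpos n)).le]
    conv_lhs => rw [← h1]
    simp only [bellman, mul_add, Finset.mul_sum]
    congr 1
    · ring
    · exact Finset.sum_congr rfl fun s' _ => by ring
  have hzeq : bellman P 0 z = z := by
    funext x
    have hl : Tendsto (fun n => y (φ n) x) atTop (𝓝 (z x)) := (tendsto_pi_nhds.mp hlim) x
    have hr : Tendsto (fun n => ‖h (φ n)‖⁻¹ * R x - ‖h (φ n)‖⁻¹ * g (φ n) * τ x +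
        ∑ s', (1 - a (φ n) * τ x) * P x s' * optionMax (y (φ n)) s') atTop
        (𝓝 (0 * R x - 0 * τ x + ∑ s', (1 - 0 * τ x) * P x s' * optionMax z s')) := by
      refine Tendsto.add (((hninv.comp hφ.tendsto_atTop).mul_const _).sub
        ((hgn.comp hφ.tendsto_atTop).mul_const _)) (tendsto_finsetSum _ fun s' _ => ?_)
      refine Tendsto.mul (Tendsto.mul_const _ (tendsto_const_nhds.sub
        ((ha0.comp hφ.tendsto_atTop).mul_const _))) ?_
      exact ((continuous_optionMax s').tendsto z).comp hlim
    simp only [← hyeq] at hr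
    rw [tendsto_nhds_unique hl hr]
    simp [bellman]
  -- The limit is constant and inherits the value 0 at `x₀`, although it lies on the unit sphere.
  have hz0 : z = 0 := by
    funext x
    rw [hconst z hzeq x x₀]
    refine tendsto_nhds_unique ((tendsto_pi_nhds.mp hlim) x₀) ?_
    simp [hy, hx₀]
  simp [hz0] at hz

/-- The optimality equation has a solution if only constants solve the homogeneous equation; the
solution is a limit of solutions of discounted equations. -/
theorem exists_bellman_eq [Nonempty S] (hP : ∀ x s', 0 ≤ P x s') (hP1 : ∀ x, ∑ s', P x s' = 1)
    (hτ : ∀ x, 1 ≤ τ x)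
    (hconst : ∀ h : S × O → ℝ, bellman P 0 h = h → ∀ x y, h x = h y) :
    ∃ (g : ℝ) (q : S × O → ℝ), bellman P (fun x => R x - g * τ x) q = q := by
  obtain ⟨x₀⟩ : Nonempty (S × O) := inferInstance
  obtain ⟨a₀, ha₀, B, hB⟩ :=
    exists_norm_le_of_bellman_eq (R := R) (τ := τ) hconst x₀ ‖R‖
  -- Discount rates tending to 0: the bound `a₀` keeps them in the range of the a priori estimate,
  -- and `‖τ‖⁻¹` keeps the weights `1 - aτ` nonnegative. Since `τ ≥ 1`, the discounted rows sum to
  -- at most `1 - a < 1`.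
  set a : ℕ → ℝ := fun n => min a₀ (‖τ‖⁻¹) * (1 / ((n : ℝ) + 1)) with ha
  have hτn : ∀ x, τ x ≤ ‖τ‖ := fun x => (le_abs_self _).trans (norm_le_pi_norm τ x)
  have hτpos : 0 < ‖τ‖ := lt_of_lt_of_le one_pos ((hτ x₀).trans (hτn x₀))
  have hmin : 0 < min a₀ (‖τ‖⁻¹) := lt_min ha₀ (inv_pos.mpr hτpos)
  have hapos : ∀ n, 0 < a n := fun n => mul_pos hmin Nat.one_div_pos_of_nat
  have hale : ∀ n, a n ≤ min a₀ (‖τ‖⁻¹) := fun n => by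
    refine mul_le_of_le_one_right hmin.le ?_
    rw [div_le_one (by positivity)]
    linarith [(Nat.cast_nonneg n : (0 : ℝ) ≤ n)]
  have haτ : ∀ n x, a n * τ x ≤ 1 := fun n x => by
    calc a n * τ x ≤ ‖τ‖⁻¹ * ‖τ‖ := mul_le_mul ((hale n).trans (min_le_right _ _)) (hτn x)
          (by linarith [hτ x]) (inv_pos.mpr hτpos).le
      _ = 1 := inv_mul_cancel₀ hτpos.ne'
  have ha1 : ∀ n, a n ≤ 1 := fun n =>
    (le_mul_of_one_le_right (hapos n).le (hτ x₀)).trans (haτ n x₀)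
  have ha0 : Tendsto a atTop (𝓝 0) := by
    have := tendsto_one_div_add_atTop_nhds_zero_nat.const_mul (min a₀ (‖τ‖⁻¹))
    rwa [mul_zero] at this
  have hWnn : ∀ n x s', 0 ≤ (1 - a n * τ x) * P x s' := fun n x s' =>
    mul_nonneg (by linarith [haτ n x]) (hP x s')
  have hfix : ∀ n, ∃ q : S × O → ℝ, bellman (fun x s' => (1 - a n * τ x) * P x s') R q = q := by
    intro n
    have hκ : ∀ x, ∑ s', (1 - a n * τ x) * P x s' ≤ (Real.toNNReal (1 - a n) : ℝ) := fun x => by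
      rw [← Finset.mul_sum, hP1, mul_one, Real.coe_toNNReal _ (by linarith [ha1 n])]
      linarith [le_mul_of_one_le_right (hapos n).le (hτ x)]
    have hcontr : ContractingWith (Real.toNNReal (1 - a n))
        (bellman (fun x s' => (1 - a n * τ x) * P x s') R) :=
      ⟨by rw [Real.toNNReal_lt_one]; linarith [hapos n], lipschitzWith_bellman (hWnn n) hκ R⟩
    exact ⟨_, hcontr.fixedPoint_isFixedPt⟩
  choose q hq using hfix
  have hqR : ∀ n, a n * ‖q n‖ ≤ ‖R‖ := fun n => by
    have h1 : ‖q n‖ ≤ ‖R‖ + (1 - a n) * ‖q n‖ := by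
      refine (pi_norm_le_iff_of_nonneg (by
        have := mul_nonneg (sub_nonneg.mpr (ha1 n)) (norm_nonneg (q n)); positivity)).mpr fun x => ?_
      conv_lhs => rw [← hq n]
      refine (norm_add_le _ _).trans (add_le_add (norm_le_pi_norm R x) ?_)
      calc ‖∑ s', (1 - a n * τ x) * P x s' * optionMax (q n) s'‖
          ≤ ∑ s', (1 - a n * τ x) * P x s' * ‖q n‖ := by
            refine norm_sum_le_of_le _ fun s' _ => ?_
            rw [norm_mul, Real.norm_of_nonneg (hWnn n x s')]
            exact mul_le_mul_of_nonneg_left (abs_optionMax_le _ _) (hWnn n x s')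
        _ ≤ (1 - a n) * ‖q n‖ := by
            rw [← Finset.sum_mul, ← Finset.mul_sum, hP1, mul_one]
            refine mul_le_mul_of_nonneg_right ?_ (norm_nonneg _)
            linarith [le_mul_of_one_le_right (hapos n).le (hτ x)]
    linarith
  -- Writing `q = h + q(x₀)` in the discounted equation leaves the term `-a τ q(x₀) = -gτ`, so `h`
  -- solves the perturbed equation with rate `g = a q(x₀)`, which stays bounded by `hqR`.
  set g : ℕ → ℝ := fun n => a n * q n x₀ with hg
  set h : ℕ → S × O → ℝ := fun n x => q n x + -q n x₀ with hh
  have hgR : ∀ n, |g n| ≤ ‖R‖ := fun n => by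
    rw [hg, abs_mul, abs_of_pos (hapos n)]
    exact (mul_le_mul_of_nonneg_left (norm_le_pi_norm (q n) x₀) (hapos n).le).trans (hqR n)
  have hheq : ∀ n, bellman (fun x s' => (1 - a n * τ x) * P x s')
      (fun x => R x - g n * τ x) (h n) = h n := fun n => by
    funext x
    have h1 := congrFun (hq n) x
    simp only [bellman] at h1
    simp only [bellman, hh, optionMax_add_const, mul_add, Finset.sum_add_distrib,
      ← Finset.sum_mul, ← Finset.mul_sum, hP1, hg]
    simp only [mul_assoc, ← Finset.mul_sum] at h1 ⊢
    linarith
  have hhB : ∀ n, ‖h n‖ ≤ B := fun n =>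
    hB (a n) ⟨(hapos n).le, (hale n).trans (min_le_left _ _)⟩ (g n) (hgR n) (h n)
      (by simp [hh]) (hheq n)
  have hmem : ∀ n, (g n, h n) ∈ Set.Icc (-‖R‖) ‖R‖ ×ˢ Metric.closedBall (0 : S × O → ℝ) B :=
    fun n => ⟨abs_le.mp (hgR n), by simpa using hhB n⟩
  obtain ⟨⟨g', h'⟩, -, φ, hφ, hlim⟩ :=
    (isCompact_Icc.prod (isCompact_closedBall (0 : S × O → ℝ) B)).tendsto_subseq hmem
  have hlg : Tendsto (fun n => g (φ n)) atTop (𝓝 g') := (continuous_fst.tendsto _).comp hlim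
  have hlh : Tendsto (fun n => h (φ n)) atTop (𝓝 h') := (continuous_snd.tendsto _).comp hlim
  refine ⟨g', h', funext fun x => ?_⟩
  have hr : Tendsto (fun n => bellman (fun x s' => (1 - a (φ n) * τ x) * P x s')
      (fun x => R x - g (φ n) * τ x) (h (φ n)) x) atTop
      (𝓝 (R x - g' * τ x + ∑ s', (1 - 0 * τ x) * P x s' * optionMax h' s')) := by
    refine Tendsto.add (tendsto_const_nhds.sub (hlg.mul_const _))
      (tendsto_finsetSum _ fun s' _ => Tendsto.mul (Tendsto.mul_const _ (tendsto_const_nhds.sub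
        ((ha0.comp hφ.tendsto_atTop).mul_const _))) ?_)
    exact ((continuous_optionMax s').tendsto h').comp hlh
  simp only [hheq] at hr
  rw [tendsto_nhds_unique ((tendsto_pi_nhds.mp hlh) x) hr]
  simp [bellman]

/-- For a fixed rate `g`, the solutions of the optimality equation that satisfy `f(q) = ρ` form a
closed, bounded and connected set, which is non-empty if the equation is solvable. -/
theorem solutions_closed_bounded_connected [Nonempty S] (hP : ∀ x s', 0 ≤ P x s')
    (hP1 : ∀ x, ∑ s', P x s' = 1)
    (hconst : ∀ h : S × O → ℝ, bellman P 0 h = h → ∀ x y, h x = h y)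
    {f : (S × O → ℝ) → ℝ} (hf : IsAdmissibleFunctional f) {g : ℝ} (ρ : ℝ)
    (hex : ∃ q : S × O → ℝ, bellman P (fun x => R x - g * τ x) q = q) :
    IsClosed {q | bellman P (fun x => R x - g * τ x) q = q ∧ f q = ρ} ∧
    Bornology.IsBounded {q | bellman P (fun x => R x - g * τ x) q = q ∧ f q = ρ} ∧
    IsConnected {q | bellman P (fun x => R x - g * τ x) q = q ∧ f q = ρ} := by
  obtain ⟨L, hL⟩ := hf.lipschitz
  obtain ⟨u, hu, -, hshift⟩ := hf.shift
  have hlip : LipschitzWith 1 (bellman P fun x => R x - g * τ x) :=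
    lipschitzWith_bellman hP (fun x => by simp [hP1]) _
  obtain ⟨x₀⟩ : Nonempty (S × O) := inferInstance
  have hshift' : ∀ (q : S × O → ℝ) (b : ℝ), f (fun x => q x + b) = f q + b * u := fun q b => by
    rw [← hshift]
    congr 1
    funext x
    simp
  refine ⟨?_, ?_, ?_⟩
  · exact (isClosed_eq hlip.continuous continuous_id).inter
      (isClosed_eq hL.continuous continuous_const)
  · obtain ⟨a₀, ha₀, B, hB⟩ :=
      exists_norm_le_of_bellman_eq (R := R) (τ := τ) hconst x₀ |g|
    -- Split `q` into `h = q - q(x₀)`, of norm at most `B`, and the constant `q(x₀)`. The shift rule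
    -- gives `q(x₀) u = ρ - f h`, and the Lipschitz bound gives `|f h| ≤ |f 0| + L B`.
    refine isBounded_iff_forall_norm_le.mpr ⟨B + (|ρ| + |f 0| + L * B) / u, ?_⟩
    rintro q ⟨hq, hfq⟩
    set h : S × O → ℝ := fun x => q x + -q x₀ with hh
    have hhB : ‖h‖ ≤ B := by
      refine hB 0 ⟨le_rfl, ha₀.le⟩ g le_rfl h (by simp [hh]) ?_
      simp only [zero_mul, sub_zero, one_mul]
      rw [hh, bellman_add_const hP1, hq]
    have hqh : q = fun x => h x + q x₀ := by
      funext x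
      simp [hh]
    have hfh : q x₀ * u = ρ - f h := by
      rw [← hfq]
      nth_rewrite 2 [hqh]
      rw [hshift']
      ring
    have hfh' : |f h| ≤ |f 0| + L * B := by
      have h1 := hL.dist_le_mul h 0
      rw [dist_zero_right, Real.dist_eq] at h1
      have h2 := abs_sub_abs_le_abs_sub (f h) (f 0)
      have h3 := mul_le_mul_of_nonneg_left hhB L.coe_nonneg
      linarith
    have hx : |q x₀| ≤ (|ρ| + |f 0| + L * B) / u := by
      rw [le_div_iff₀ hu, ← abs_of_pos hu, ← abs_mul, hfh]
      have := abs_sub ρ (f h)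
      linarith
    refine (pi_norm_le_iff_of_nonempty q).mpr fun x => ?_
    rw [hqh]
    exact (norm_add_le _ _).trans (add_le_add ((norm_le_pi_norm h x).trans hhB) hx)
  · have hpre := isPreconnected_fixedPoints_of_monotone_convex (monotone_bellman hP _) hlip
      fun x y t ht => bellman_convex hP (fun x => R x - g * τ x) x y ht
    -- Shifting by `(ρ - f q) / u` keeps a fixed point fixed, makes `f` equal to `ρ`, and does
    -- nothing if `f q = ρ` already.
    have himage : {q | bellman P (fun x => R x - g * τ x) q = q ∧ f q = ρ} =
        (fun q : S × O → ℝ => fun x => q x + (ρ - f q) / u) ''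
          Function.fixedPoints (bellman P fun x => R x - g * τ x) := by
      ext q
      constructor
      · rintro ⟨hq, hfq⟩
        exact ⟨q, hq, by simp [hfq]⟩
      · rintro ⟨p, hp, rfl⟩
        refine ⟨?_, ?_⟩
        · rw [bellman_add_const hP1, hp.eq]
        · rw [hshift', div_mul_cancel₀ _ hu.ne']
          ring
    rw [himage]
    obtain ⟨q, hq⟩ := hex
    refine IsConnected.image (s := Function.fixedPoints _) ⟨⟨q, hq⟩, hpre⟩ _ (Continuous.continuousOn ?_)
    have := hL.continuous
    fun_prop

end Model

end Bellman

/-! ### Stochastic matrices -/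

section Stochastic

variable {S : Type*} [Fintype S]

/-- If a weighted mean is at most a lower bound on the support of the weights, then the function
equals that bound on the support. -/
theorem eq_of_weighted_sum_le {w v : S → ℝ} {m : ℝ} (hw : ∀ x, 0 ≤ w x) (hw1 : ∑ x, w x = 1)
    (hm : ∀ x, 0 < w x → m ≤ v x) (hle : ∑ x, w x * v x ≤ m) {x : S} (hx : 0 < w x) :
    v x = m := by
  have hnn : ∀ y, 0 ≤ w y * (v y - m) := fun y => by
    rcases (hw y).eq_or_lt with h | h
    · simp [← h]
    · exact mul_nonneg h.le (sub_nonneg.mpr (hm y h))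
  have hsum : ∑ y, w y * (v y - m) = ∑ y, w y * v y - m := by
    simp only [mul_sub, Finset.sum_sub_distrib, ← Finset.sum_mul, hw1, one_mul]
  have h0 : ∑ y, w y * (v y - m) = 0 :=
    le_antisymm (by linarith) (Finset.sum_nonneg fun y _ => hnn y)
  have h1 := (Finset.sum_eq_zero_iff_of_nonneg fun y _ => hnn y).mp h0 x (Finset.mem_univ x)
  have := (mul_eq_zero.mp h1).resolve_left hx.ne'
  linarith

variable [DecidableEq S] {M : Matrix S S ℝ}

theorem Matrix.sum_pow_apply (hM1 : ∀ s, ∑ t, M s t = 1) (n : ℕ) (s : S) :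
    ∑ t, (M ^ n) s t = 1 := by
  induction n with
  | zero => simp [Matrix.one_apply]
  | succ n ih =>
    simp only [pow_succ, Matrix.mul_apply]
    rw [Finset.sum_comm]
    simp only [← Finset.mul_sum, hM1, mul_one, ih]

theorem Matrix.mul_le_pow_add_apply (hM : ∀ s t, 0 ≤ M s t) (m n : ℕ) (s x t : S) :
    (M ^ m) s x * (M ^ n) x t ≤ (M ^ (m + n)) s t := by
  rw [pow_add, Matrix.mul_apply]
  exact Finset.single_le_sum (f := fun x => (M ^ m) s x * (M ^ n) x t)
    (fun y _ => mul_nonneg (pow_apply_nonneg hM m s y) (pow_apply_nonneg hM n y t))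
    (Finset.mem_univ x)

theorem Matrix.mem_of_pow_apply_pos (hM : ∀ s t, 0 ≤ M s t) {A : Set S}
    (hA : ∀ s ∈ A, ∀ t, 0 < M s t → t ∈ A) (n : ℕ) :
    ∀ s ∈ A, ∀ t, 0 < (M ^ n) s t → t ∈ A := by
  induction n with
  | zero =>
    intro s hs t h
    rw [pow_zero, Matrix.one_apply] at h
    split_ifs at h with hst
    · exact hst ▸ hs
    · exact absurd h (lt_irrefl 0)
  | succ n ih =>
    intro s hs t h
    rw [pow_succ, Matrix.mul_apply] at h
    obtain ⟨x, -, hx⟩ := Finset.exists_lt_of_sum_lt (f := fun _ => (0 : ℝ)) (by simpa using h)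
    have h1 : 0 < (M ^ n) s x :=
      (pow_apply_nonneg hM n s x).lt_of_ne fun h0 => by simp [← h0] at hx
    have h2 : 0 < M x t := (hM x t).lt_of_ne fun h0 => by simp [← h0] at hx
    exact hA x (ih s hs x h1) t h2

/-- A non-empty closed set of a finite Markov chain contains a state that is not transient. -/
theorem Matrix.exists_not_summable_pow (hM : ∀ s t, 0 ≤ M s t) (hM1 : ∀ s, ∑ t, M s t = 1)
    {A : Set S} (hne : A.Nonempty) (hA : ∀ s ∈ A, ∀ t, 0 < M s t → t ∈ A) :
    ∃ s ∈ A, ¬ Summable fun n : ℕ => (M ^ n) s s := by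
  classical
  let reach : S → Finset S := fun s => Finset.univ.filter fun x => ∃ n : ℕ, 0 < (M ^ n) s x
  have hreach : ∀ s x, x ∈ reach s ↔ ∃ n : ℕ, 0 < (M ^ n) s x := fun s x => by simp [reach]
  -- A state with the fewest reachable states is reached back from everything it reaches.
  obtain ⟨s, hs, hmin⟩ := Set.exists_min_image A (fun s => (reach s).card) A.toFinite hne
  refine ⟨s, hs, fun hsum => ?_⟩
  have hback : ∀ x ∈ reach s, ∃ n : ℕ, 0 < (M ^ n) x s := fun x hx => by
    obtain ⟨n, hn⟩ := (hreach s x).mp hx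
    have hsub : reach x ⊆ reach s := fun y hy => by
      obtain ⟨m, hm⟩ := (hreach x y).mp hy
      exact (hreach s y).mpr ⟨n + m, (mul_pos hn hm).trans_le (mul_le_pow_add_apply hM n m s x y)⟩
    have hxA := mem_of_pow_apply_pos hM hA n s hs x hn
    have heq := Finset.eq_of_subset_of_card_le hsub (hmin x hxA)
    exact (hreach x s).mp (heq ▸ (hreach s s).mpr ⟨0, by simp⟩)
  -- If the returns to `s` were summable, then `(M ^ n) s x * (M ^ k) x s ≤ (M ^ (n + k)) s s` would
  -- send every entry of row `s` to 0, whereas the row always sums to 1.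
  have htend : ∀ x, Tendsto (fun n : ℕ => (M ^ n) s x) atTop (𝓝 0) := fun x => by
    by_cases hx : x ∈ reach s
    · obtain ⟨k, hk⟩ := hback x hx
      have h0 : Tendsto (fun n : ℕ => (M ^ (n + k)) s s / (M ^ k) x s) atTop (𝓝 0) := by
        simpa using (hsum.tendsto_atTop_zero.comp (tendsto_add_atTop_nat k)).div_const
          ((M ^ k) x s)
      exact squeeze_zero (fun n => pow_apply_nonneg hM n s x)
        (fun n => (le_div_iff₀ hk).mpr (mul_le_pow_add_apply hM n k s x s)) h0
    · have h0 : ∀ n : ℕ, (M ^ n) s x = 0 := fun n => by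
        by_contra h
        exact hx ((hreach s x).mpr ⟨n, (pow_apply_nonneg hM n s x).lt_of_ne' h⟩)
      simp [h0]
  have h1 := tendsto_finsetSum Finset.univ fun x (_ : x ∈ Finset.univ) => htend x
  simp only [sum_pow_apply hM1, Finset.sum_const_zero] at h1
  exact one_ne_zero (tendsto_nhds_unique tendsto_const_nhds h1)

theorem Matrix.abs_pow_mulVec_le (hM : ∀ s t, 0 ≤ M s t) (hM1 : ∀ s, ∑ t, M s t = 1)
    (n : ℕ) (v : S → ℝ) (s : S) : |(M ^ n).mulVec v s| ≤ ‖v‖ := by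
  calc |(M ^ n).mulVec v s| ≤ ∑ t, (M ^ n) s t * ‖v‖ := by
        refine (Finset.abs_sum_le_sum_abs _ _).trans (Finset.sum_le_sum fun t _ => ?_)
        rw [abs_mul, abs_of_nonneg (pow_apply_nonneg hM n s t)]
        exact mul_le_mul_of_nonneg_left (norm_le_pi_norm v t) (pow_apply_nonneg hM n s t)
    _ = ‖v‖ := by rw [← Finset.sum_mul, sum_pow_apply hM1, one_mul]

theorem Matrix.pow_mulVec_mono (hM : ∀ s t, 0 ≤ M s t) (n : ℕ) {v w : S → ℝ} (h : v ≤ w) :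
    (M ^ n).mulVec v ≤ (M ^ n).mulVec w := fun s =>
  Finset.sum_le_sum fun t _ => mul_le_mul_of_nonneg_left (h t) (pow_apply_nonneg hM n s t)

end Stochastic

/-! ### From the kernel to its means -/

namespace IsSMDP

variable {S O : Type*} {K : SMDPKernel S O}

theorem summable (hK : IsSMDP K) (s : S) (o : O) :
    Summable fun x : S × ℝ × ℕ => K s o x.1 x.2.1 x.2.2 := (hK.hasSum_one s o).summable

theorem trans_nonneg (hK : IsSMDP K) (s : S) (o : O) (s' : S) : 0 ≤ K.trans s o s' :=
  tsum_nonneg fun _ => hK.nonneg _ _ _ _ _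

theorem one_le_meanLength (hK : IsSMDP K) (s : S) (o : O) : 1 ≤ K.meanLength s o := by
  rw [← (hK.hasSum_one s o).tsum_eq]
  refine Summable.tsum_le_tsum (fun x => ?_) (hK.summable s o) (hK.summable_length s o)
  obtain ⟨s', r, l⟩ := x
  rcases l.eq_zero_or_pos with rfl | hl
  · simp [hK.length_pos]
  · exact le_mul_of_one_le_right (hK.nonneg _ _ _ _ _) (by exact_mod_cast hl)

variable [Fintype S]

theorem summable_mul_fst (hK : IsSMDP K) (s : S) (o : O) (v : S → ℝ) :
    Summable fun x : S × ℝ × ℕ => K s o x.1 x.2.1 x.2.2 * v x.1 := by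
  refine Summable.of_norm_bounded ((hK.summable s o).mul_right ‖v‖) fun x => ?_
  rw [norm_mul, Real.norm_of_nonneg (hK.nonneg _ _ _ _ _)]
  exact mul_le_mul_of_nonneg_left (norm_le_pi_norm v x.1) (hK.nonneg _ _ _ _ _)

theorem tsum_mul_fst (hK : IsSMDP K) (s : S) (o : O) (v : S → ℝ) :
    ∑' x : S × ℝ × ℕ, K s o x.1 x.2.1 x.2.2 * v x.1 = ∑ s', K.trans s o s' * v s' := by
  rw [(hK.summable_mul_fst s o v).tsum_prod, tsum_fintype]
  exact Finset.sum_congr rfl fun s' _ => by simp only [tsum_mul_right, SMDPKernel.trans]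

theorem sum_trans (hK : IsSMDP K) (s : S) (o : O) : ∑ s', K.trans s o s' = 1 := by
  have h := hK.tsum_mul_fst s o fun _ => 1
  simp only [mul_one] at h
  rw [← h, (hK.hasSum_one s o).tsum_eq]

/-- The reward, length and value terms are separately summable, so the series splits and only the
means of the kernel matter. -/
theorem optimalityEquation_iff [Fintype O] [Nonempty O] (hK : IsSMDP K) (g : ℝ)
    (q : S × O → ℝ) : K.OptimalityEquation g q ↔
      bellman (fun x => K.trans x.1 x.2)
        (fun x => K.meanReward x.1 x.2 - g * K.meanLength x.1 x.2) q = q := by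
  have key : ∀ s o, ∑' x : S × ℝ × ℕ, K s o x.1 x.2.1 x.2.2 *
      (x.2.1 - g * (x.2.2 : ℝ) + Finset.univ.sup' Finset.univ_nonempty (fun o' => q (x.1, o'))) =
      bellman (fun x => K.trans x.1 x.2)
        (fun x => K.meanReward x.1 x.2 - g * K.meanLength x.1 x.2) q (s, o) := fun s o => by
    have hr : Summable fun x : S × ℝ × ℕ => K s o x.1 x.2.1 x.2.2 * x.2.1 := by
      refine Summable.of_norm_bounded (hK.summable_reward s o) fun x => ?_
      rw [norm_mul, Real.norm_of_nonneg (hK.nonneg _ _ _ _ _), Real.norm_eq_abs]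
    have hl := (hK.summable_length s o).mul_left g
    have hv := hK.summable_mul_fst s o (optionMax q)
    have h := ((hr.hasSum.sub hl.hasSum).add hv.hasSum).tsum_eq
    rw [tsum_mul_left, hK.tsum_mul_fst] at h
    refine Eq.trans (tsum_congr fun x => ?_) h
    simp only [optionMax]
    ring
  simp only [SMDPKernel.OptimalityEquation, key]
  exact ⟨fun h => funext fun x => (h x.1 x.2).symm, fun h s o => (congrFun h (s, o)).symm⟩

end IsSMDP

/-! ### Stationary policies -/

section Policy

variable {S O : Type*} [Fintype O]

theorem StationaryPolicy.sum_prob_mul_const (π : StationaryPolicy S O) (s : S) (c : ℝ) :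
    ∑ o, π.prob s o * c = c := by
  rw [← Finset.sum_mul, π.prob_sum, one_mul]

open Classical in
/-- The deterministic policy that chooses the option `d s` in the state `s`. -/
def StationaryPolicy.ofFun (d : S → O) : StationaryPolicy S O where
  prob s o := if o = d s then 1 else 0
  prob_nonneg s o := by split_ifs <;> norm_num
  prob_sum s := by simp

theorem StationaryPolicy.sum_ofFun_mul (d : S → O) (s : S) (c : O → ℝ) :
    ∑ o, (StationaryPolicy.ofFun d).prob s o * c o = c (d s) := by
  classical
  simp [StationaryPolicy.ofFun]

variable {K : SMDPKernel S O}

namespace IsSMDP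

theorem policyMatrix_nonneg (hK : IsSMDP K) (π : StationaryPolicy S O) (s t : S) :
    0 ≤ K.policyMatrix π s t :=
  Finset.sum_nonneg fun o _ => mul_nonneg (π.prob_nonneg s o) (hK.trans_nonneg s o t)

theorem _root_.SMDPKernel.IsClosedSet.policyMatrix (hK : IsSMDP K) {C : Set S}
    (hC : K.IsClosedSet C) (π : StationaryPolicy S O) :
    ∀ s ∈ C, ∀ t, 0 < K.policyMatrix π s t → t ∈ C := by
  intro s hs t h
  obtain ⟨o, -, ho⟩ := Finset.exists_lt_of_sum_lt (f := fun _ => (0 : ℝ))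
    (g := fun o => π.prob s o * K.trans s o t) (s := Finset.univ)
    (by simpa [SMDPKernel.policyMatrix] using h)
  exact hC s hs o t ((hK.trans_nonneg s o t).lt_of_ne fun h0 => by simp [← h0] at ho)

variable [Fintype S]

theorem sum_policyMatrix (hK : IsSMDP K) (π : StationaryPolicy S O) (s : S) :
    ∑ t, K.policyMatrix π s t = 1 := by
  simp only [SMDPKernel.policyMatrix, Matrix.of_apply]
  rw [Finset.sum_comm]
  simp only [← Finset.mul_sum, hK.sum_trans, mul_one, π.prob_sum]

theorem sum_policyMatrix_mul (K : SMDPKernel S O) (π : StationaryPolicy S O) (s : S)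
    (v : S → ℝ) :
    ∑ t, K.policyMatrix π s t * v t = ∑ o, π.prob s o * ∑ t, K.trans s o t * v t := by
  simp only [SMDPKernel.policyMatrix, Matrix.of_apply, Finset.sum_mul, Finset.mul_sum]
  rw [Finset.sum_comm]
  exact Finset.sum_congr rfl fun o _ => Finset.sum_congr rfl fun t _ => mul_assoc _ _ _

variable [DecidableEq S]

/-- In a weakly communicating SMDP only constants solve the homogeneous optimality equation. -/
theorem eq_const_of_bellman_eq [Nonempty S] [Nonempty O] (hK : IsSMDP K)
    (hwc : K.WeaklyCommunicating) (h : S × O → ℝ)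
    (hh : bellman (fun x => K.trans x.1 x.2) 0 h = h) (x y : S × O) : h x = h y := by
  obtain ⟨C, hCne, hCcl, ⟨π, hπ⟩, htr⟩ := hwc
  set v := optionMax h with hv
  have hhv : ∀ s o, h (s, o) = ∑ t, K.trans s o t * v t := fun s o => by
    conv_lhs => rw [← hh]
    simp [bellman, hv]
  -- The maximum over options dominates any average over them, so `v` is superharmonic for every
  -- policy.
  have hsuper : ∀ (ϖ : StationaryPolicy S O) (s : S),
      ∑ t, K.policyMatrix ϖ s t * v t ≤ v s := fun ϖ s => by
    rw [sum_policyMatrix_mul]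
    conv_rhs => rw [← ϖ.sum_prob_mul_const s (v s)]
    refine Finset.sum_le_sum fun o _ => mul_le_mul_of_nonneg_left ?_ (ϖ.prob_nonneg s o)
    rw [← hhv]
    exact le_optionMax h s o
  have hpow : ∀ (n : ℕ) (s : S), ∑ t, (K.policyMatrix π ^ n) s t * v t ≤ v s := by
    intro n
    induction n with
    | zero => intro s; simp [Matrix.one_apply]
    | succ n ih =>
      intro s
      refine le_trans ?_ (ih s)
      simp only [pow_succ, Matrix.mul_apply, Finset.sum_mul]
      rw [Finset.sum_comm]
      refine Finset.sum_le_sum fun x _ => ?_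
      simp only [mul_assoc, ← Finset.mul_sum]
      exact mul_le_mul_of_nonneg_left (hsuper π x)
        (Matrix.pow_apply_nonneg (hK.policyMatrix_nonneg π) n s x)
  -- A set closed under some policy contains a state that is not transient, and such states lie in
  -- `C`.
  have hnoclosed : ∀ (ϖ : StationaryPolicy S O) (A : Set S), A.Nonempty →
      (∀ s ∈ A, ∀ t, 0 < K.policyMatrix ϖ s t → t ∈ A) → ∃ s ∈ A, s ∈ C := by
    intro ϖ A hne hA
    by_contra! hcon
    obtain ⟨s, hs, hns⟩ := Matrix.exists_not_summable_pow (hK.policyMatrix_nonneg ϖ)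
      (hK.sum_policyMatrix ϖ) hne hA
    exact hns (htr s (hcon s hs) ϖ)
  obtain ⟨c, hcC, hcmin⟩ := Set.exists_min_image C v C.toFinite hCne
  -- The minimum principle on `C`: from a minimizer the communicating policy reaches all of `C`
  -- without leaving it.
  have hC : ∀ s ∈ C, v s = v c := fun s hs => by
    obtain ⟨n, hn⟩ := hπ c hcC s hs
    exact eq_of_weighted_sum_le (Matrix.pow_apply_nonneg (hK.policyMatrix_nonneg π) n c)
      (Matrix.sum_pow_apply (hK.sum_policyMatrix π) n c)
      (fun t ht => hcmin t (Matrix.mem_of_pow_apply_pos (hK.policyMatrix_nonneg π)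
        (hCcl.policyMatrix hK π) n c hcC t ht)) (hpow n c) hn
  obtain ⟨m, hm⟩ := Finite.exists_min v
  obtain ⟨m', hm'⟩ := Finite.exists_max v
  -- By superharmonicity the global minimizers form a closed set, which must meet `C`.
  have hlow : v m = v c := by
    obtain ⟨s, hs, hsC⟩ := hnoclosed π {s | v s = v m} ⟨m, rfl⟩ fun s hs t ht =>
      eq_of_weighted_sum_le (hK.policyMatrix_nonneg π s) (hK.sum_policyMatrix π s)
        (fun t _ => hm t) ((hsuper π s).trans hs.le) ht
    exact hs.symm.trans (hC s hsC)
  -- Under a greedy policy `v` is harmonic, so the maximizers also form a closed set; the minimum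
  -- principle is applied to `-v`.
  have hupp : v m' = v c := by
    choose d hd using exists_eq_optionMax h
    obtain ⟨s, hs, hsC⟩ := hnoclosed (StationaryPolicy.ofFun d) {s | v s = v m'} ⟨m', rfl⟩ <| by
      intro s hs t ht
      have := eq_of_weighted_sum_le (v := fun t => -v t) (m := -v m')
        (hK.policyMatrix_nonneg (StationaryPolicy.ofFun d) s)
        (hK.sum_policyMatrix (StationaryPolicy.ofFun d) s) (fun t _ => neg_le_neg (hm' t)) (by
          simp only [mul_neg, Finset.sum_neg_distrib]
          rw [sum_policyMatrix_mul, StationaryPolicy.sum_ofFun_mul, ← hhv, ← hd s]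
          exact neg_le_neg hs.ge) ht
      exact neg_injective this
    exact hs.symm.trans (hC s hsC)
  have hvc : ∀ s, v s = v c := fun s =>
    le_antisymm ((hm' s).trans hupp.le) (hlow.ge.trans (hm s))
  have hconst : ∀ s o, h (s, o) = v c := fun s o => by
    rw [hhv]
    simp only [hvc, ← Finset.sum_mul, hK.sum_trans, one_mul]
  exact (hconst x.1 x.2).trans (hconst y.1 y.2).symm

/-- The expected total length of `n` epochs is at least `n`. -/
theorem le_totalLength (hK : IsSMDP K) (π : StationaryPolicy S O) (n : ℕ) (s : S) :
    (n : ℝ) ≤ K.totalLength π n s := by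
  have h1 : (fun _ => 1 : S → ℝ) ≤ K.policyLength π := fun t => by
    rw [← π.sum_prob_mul_const t 1]
    exact Finset.sum_le_sum fun o _ =>
      mul_le_mul_of_nonneg_left (hK.one_le_meanLength t o) (π.prob_nonneg t o)
  have h2 : ∀ i ∈ Finset.range n, (1 : ℝ) ≤
      ((K.policyMatrix π ^ i).mulVec (K.policyLength π)) s := fun i _ => by
    have h3 := Matrix.pow_mulVec_mono (hK.policyMatrix_nonneg π) i h1 s
    simpa [Matrix.mulVec, dotProduct, Matrix.sum_pow_apply (hK.sum_policyMatrix π)] using h3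
  simpa [SMDPKernel.totalLength] using Finset.sum_le_sum h2

/-- The total reward in excess of the rate `g`, telescoped along the chain. -/
theorem sum_pow_mulVec_sub (K : SMDPKernel S O) (π : StationaryPolicy S O) (v : S → ℝ) (n : ℕ)
    (s : S) :
    ∑ i ∈ Finset.range n, ((K.policyMatrix π ^ i).mulVec (v - (K.policyMatrix π).mulVec v)) s =
      v s - (K.policyMatrix π ^ n).mulVec v s := by
  induction n with
  | zero => simp
  | succ n ih =>
    rw [Finset.sum_range_succ, ih, Matrix.mulVec_sub, Matrix.mulVec_mulVec, ← pow_succ]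
    simp

theorem totalReward_sub (K : SMDPKernel S O) (π : StationaryPolicy S O) (g : ℝ) (n : ℕ)
    (s : S) : K.totalReward π n s - g * K.totalLength π n s =
      ∑ i ∈ Finset.range n, ((K.policyMatrix π ^ i).mulVec
        (K.policyReward π - g • K.policyLength π)) s := by
  simp only [SMDPKernel.totalReward, SMDPKernel.totalLength, Finset.mul_sum,
    ← Finset.sum_sub_distrib, Matrix.mulVec_sub, Matrix.mulVec_smul]
  rfl

/-- The rate in a solution of the optimality equation is the optimal reward rate. -/
theorem isOptimalRate [Nonempty O] (hK : IsSMDP K) {g : ℝ} {q : S × O → ℝ}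
    (hq : K.OptimalityEquation g q) : K.IsOptimalRate g := by
  rw [hK.optimalityEquation_iff] at hq
  set v := optionMax q with hv
  have hqv : ∀ s o, K.meanReward s o - g * K.meanLength s o =
      q (s, o) - ∑ t, K.trans s o t * v t := fun s o => by
    rw [eq_sub_iff_add_eq]
    exact congrFun hq (s, o)
  have hexc : ∀ (π : StationaryPolicy S O) (s : S),
      (K.policyReward π - g • K.policyLength π) s =
        ∑ o, π.prob s o * q (s, o) - (K.policyMatrix π).mulVec v s := fun π s => by
    have h1 : (K.policyMatrix π).mulVec v s = ∑ o, π.prob s o * ∑ t, K.trans s o t * v t :=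
      sum_policyMatrix_mul K π s v
    rw [h1, ← Finset.sum_sub_distrib]
    simp only [← mul_sub, ← hqv]
    simp only [mul_sub, Finset.sum_sub_distrib, SMDPKernel.policyReward,
      SMDPKernel.policyLength, Pi.sub_apply, Pi.smul_apply, smul_eq_mul, Finset.mul_sum]
    congr 1
    exact Finset.sum_congr rfl fun o _ => by ring
  -- The mean excess over rate `g` in one epoch is at most `v - P v`; this telescopes to `v - P^n
  -- v`, bounded by `2‖v‖` for all `n`, while the total length grows at least like `n`.
  have hle : ∀ (π : StationaryPolicy S O) (n : ℕ) (s : S),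
      K.totalReward π n s - g * K.totalLength π n s ≤ 2 * ‖v‖ := fun π n s => by
    rw [totalReward_sub]
    refine (Finset.sum_le_sum fun i _ => Matrix.pow_mulVec_mono (hK.policyMatrix_nonneg π) i
      (w := v - (K.policyMatrix π).mulVec v) (fun t => ?_) s).trans ?_
    · rw [hexc, Pi.sub_apply]
      refine sub_le_sub_right ?_ _
      conv_rhs => rw [← π.sum_prob_mul_const t (v t)]
      exact Finset.sum_le_sum fun o _ =>
        mul_le_mul_of_nonneg_left (le_optionMax q t o) (π.prob_nonneg t o)
    · rw [sum_pow_mulVec_sub]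
      have h1 := (abs_le.mp (Matrix.abs_pow_mulVec_le (hK.policyMatrix_nonneg π)
        (hK.sum_policyMatrix π) n v s)).1
      have h2 := (le_abs_self _).trans (norm_le_pi_norm v s)
      linarith
  have hinv : Tendsto (fun n : ℕ => 2 * ‖v‖ / n) atTop (𝓝 0) :=
    tendsto_const_div_atTop_nhds_zero_nat _
  have hdiv : ∀ (π : StationaryPolicy S O) (s : S) (n : ℕ), 0 < n →
      K.totalReward π n s / K.totalLength π n s - g =
        (K.totalReward π n s - g * K.totalLength π n s) / K.totalLength π n s ∧
      0 < K.totalLength π n s := fun π s n hn => by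
    have : 0 < K.totalLength π n s :=
      lt_of_lt_of_le (by exact_mod_cast hn) (hK.le_totalLength π n s)
    exact ⟨by field_simp, this⟩
  have hfrac : ∀ (π : StationaryPolicy S O) (s : S) (n : ℕ), 0 < n →
      2 * ‖v‖ / K.totalLength π n s ≤ 2 * ‖v‖ / n := fun π s n hn =>
    div_le_div_of_nonneg_left (by positivity) (by exact_mod_cast hn) (hK.le_totalLength π n s)
  intro s
  refine ⟨?_, fun b hb => hb ?_⟩
  · rintro ρ ⟨π, hρ⟩
    have h1 : Tendsto (fun n : ℕ => g + 2 * ‖v‖ / n) atTop (𝓝 g) := by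
      simpa using hinv.const_add g
    refine le_of_tendsto_of_tendsto hρ h1 ?_
    filter_upwards [eventually_gt_atTop 0] with n hn
    obtain ⟨h2, h3⟩ := hdiv π s n hn
    have h4 := div_le_div_of_nonneg_right (hle π n s) h3.le
    have h5 := hfrac π s n hn
    linarith
  -- A greedy policy turns the inequality into an equality, so its reward rate exists and equals
  -- `g`: the supremum is attained.
  · choose d hd using exists_eq_optionMax q
    refine ⟨StationaryPolicy.ofFun d, tendsto_iff_norm_sub_tendsto_zero.mpr ?_⟩
    refine squeeze_zero' (Eventually.of_forall fun _ => norm_nonneg _) ?_ hinv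
    filter_upwards [eventually_gt_atTop 0] with n hn
    obtain ⟨h2, h3⟩ := hdiv (StationaryPolicy.ofFun d) s n hn
    rw [h2, norm_div, Real.norm_of_nonneg h3.le]
    refine (div_le_div_of_nonneg_right ?_ h3.le).trans (hfrac (StationaryPolicy.ofFun d) s n hn)
    have h4 : K.policyReward (StationaryPolicy.ofFun d) -
        g • K.policyLength (StationaryPolicy.ofFun d) =
        v - (K.policyMatrix (StationaryPolicy.ofFun d)).mulVec v := funext fun t => by
      rw [hexc, StationaryPolicy.sum_ofFun_mul, ← hd t, Pi.sub_apply]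
    rw [totalReward_sub, h4, sum_pow_mulVec_sub]
    have h5 := Matrix.abs_pow_mulVec_le (hK.policyMatrix_nonneg (StationaryPolicy.ofFun d))
        (hK.sum_policyMatrix (StationaryPolicy.ofFun d)) n v s
    have h6 := norm_le_pi_norm v s
    have h7 := norm_sub_le (v s) ((K.policyMatrix (StationaryPolicy.ofFun d) ^ n).mulVec v s)
    rw [Real.norm_eq_abs ((K.policyMatrix (StationaryPolicy.ofFun d) ^ n).mulVec v s)] at h7
    linarith

/-- Both rates are the least upper bound of the same set of reward rates. Hence the existential rate
in `solutionSet` has only one possible value. -/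
theorem optimalityEquation_rate_unique [Nonempty S] [Nonempty O] (hK : IsSMDP K) {g g' : ℝ}
    {q q' : S × O → ℝ} (hq : K.OptimalityEquation g q) (hq' : K.OptimalityEquation g' q') :
    g = g' := by
  obtain ⟨s⟩ : Nonempty S := inferInstance
  exact (hK.isOptimalRate hq s).unique (hK.isOptimalRate hq' s)

/-- In a weakly communicating SMDP the optimal reward rate exists, and the set of the solutions of
the optimality equation with `f(q) = r̂_*` is non-empty, closed, bounded and connected. -/
theorem exists_optimalRate_solutionSet [Nonempty S] [Nonempty O] (hK : IsSMDP K)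
    (hwc : K.WeaklyCommunicating) {f : (S × O → ℝ) → ℝ} (hf : IsAdmissibleFunctional f) :
    ∃ rStar : ℝ, K.IsOptimalRate rStar ∧
        (K.solutionSet f rStar).Nonempty ∧
        IsClosed (K.solutionSet f rStar) ∧
        Bornology.IsBounded (K.solutionSet f rStar) ∧
        IsConnected (K.solutionSet f rStar) := by
  have hP : ∀ (x : S × O) s', 0 ≤ K.trans x.1 x.2 s' := fun x => hK.trans_nonneg x.1 x.2
  have hP1 : ∀ x : S × O, ∑ s', K.trans x.1 x.2 s' = 1 := fun x => hK.sum_trans x.1 x.2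
  obtain ⟨g, q, hq⟩ := exists_bellman_eq (R := fun x => K.meanReward x.1 x.2) hP hP1
    (fun x => hK.one_le_meanLength x.1 x.2) (hK.eq_const_of_bellman_eq hwc)
  have hset : K.solutionSet f g = {q | bellman (fun x => K.trans x.1 x.2)
      (fun x => K.meanReward x.1 x.2 - g * K.meanLength x.1 x.2) q = q ∧ f q = g} := by
    ext p
    refine and_congr_left fun _ => ⟨?_, fun hp => ⟨g, (hK.optimalityEquation_iff g p).mpr hp⟩⟩
    rintro ⟨g', hp⟩
    rw [hK.optimalityEquation_rate_unique hp ((hK.optimalityEquation_iff g q).mpr hq)] at hp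
    exact (hK.optimalityEquation_iff g p).mp hp
  obtain ⟨hcl, hbd, hconn⟩ := solutions_closed_bounded_connected
    (R := fun x : S × O => K.meanReward x.1 x.2) (τ := fun x => K.meanLength x.1 x.2) hP hP1
    (hK.eq_const_of_bellman_eq hwc) hf g ⟨q, hq⟩
  rw [← hset] at hcl hbd hconn
  exact ⟨g, hK.isOptimalRate ((hK.optimalityEquation_iff g q).mpr hq), hconn.nonempty, hcl, hbd,
    hconn⟩

end IsSMDP

end Policy

/-! ### The SMDP of a finite MDP with options -/

namespace FiniteMDP

variable {S A O : Type*} [Fintype S] [Fintype A] (M : FiniteMDP S A)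
  (ω : MDPOption S A)

/-- The expectation of `w` at the next state, when `ω` is executed for one stage in `s`. -/
def stageMean (w : S → ℝ) (s : S) : ℝ :=
  ∑ a, ω.pol a s * ∑ t : S, ∑ ρ : M.rewards, M.p t ρ s a * w t

theorem stageMean_mono {v w : S → ℝ} (h : v ≤ w) : M.stageMean ω v ≤ M.stageMean ω w := fun s =>
  Finset.sum_le_sum fun a _ => mul_le_mul_of_nonneg_left (Finset.sum_le_sum fun t _ =>
    Finset.sum_le_sum fun ρ _ => mul_le_mul_of_nonneg_left (h t) (M.p_nonneg t ρ s a))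
    (ω.pol_nonneg a s)

theorem stageMean_sub (v w : S → ℝ) (s : S) :
    M.stageMean ω (fun t => v t - w t) s = M.stageMean ω v s - M.stageMean ω w s := by
  simp only [stageMean, mul_sub, Finset.sum_sub_distrib]

theorem stageMean_const_mul (c : ℝ) (w : S → ℝ) (s : S) :
    M.stageMean ω (fun t => c * w t) s = c * M.stageMean ω w s := by
  simp only [stageMean, Finset.mul_sum]
  refine Finset.sum_congr rfl fun a _ => Finset.sum_congr rfl fun t _ =>
    Finset.sum_congr rfl fun ρ _ => by ring

theorem stageMean_one (s : S) : M.stageMean ω (fun _ => 1) s = 1 := by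
  simp only [stageMean, mul_one, M.p_sum, ω.pol_sum]

/-- The probability that `ω`, started in `s`, does not terminate in the first `n` stages. -/
def survival : ℕ → S → ℝ
  | 0, _ => 1
  | n + 1, s => M.stageMean ω (fun t => (1 - ω.term t) * survival n t) s

theorem survival_nonneg (n : ℕ) : ∀ s, 0 ≤ M.survival ω n s := by
  induction n with
  | zero => intro s; exact zero_le_one
  | succ n ih =>
    intro s
    have h := M.stageMean_mono ω (v := fun t => 0 * 1)
      (w := fun t => (1 - ω.term t) * M.survival ω n t)
      (fun t => by
        have := mul_nonneg (sub_nonneg.mpr (ω.term_le_one t)) (ih t)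
        simpa using this) s
    rwa [stageMean_const_mul, zero_mul] at h

theorem survival_le_one (n : ℕ) : ∀ s, M.survival ω n s ≤ 1 := by
  induction n with
  | zero => intro s; exact le_rfl
  | succ n ih =>
    intro s
    have h := M.stageMean_mono ω (v := fun t => (1 - ω.term t) * M.survival ω n t)
      (w := fun _ => 1) (fun t => mul_le_one₀ (by linarith [ω.term_nonneg t])
        (M.survival_nonneg ω n t) (ih t)) s
    rwa [stageMean_one] at h

/-- Wherever the option is after `n` stages, surviving `N` more has probability at most `θ`; for `θ
< 1` this is geometric decay in blocks of length `N`. -/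
theorem survival_add_le {N : ℕ} {θ : ℝ} (hθ : ∀ s, M.survival ω N s ≤ θ) (n : ℕ) :
    ∀ s, M.survival ω (n + N) s ≤ θ * M.survival ω n s := by
  induction n with
  | zero => intro s; simpa [survival] using hθ s
  | succ n ih =>
    intro s
    rw [Nat.succ_add]
    simp only [survival]
    rw [← stageMean_const_mul]
    refine M.stageMean_mono ω (fun t => ?_) s
    have := mul_le_mul_of_nonneg_left (ih t) (sub_nonneg.mpr (ω.term_le_one t))
    dsimp only
    linarith

/-- If in every state the option terminates within `N` stages with positive probability, then the
survival probabilities are summable. -/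
theorem summable_survival [Nonempty S] {N : ℕ} (hN : ∀ s, M.survival ω N s < 1) (s : S) :
    Summable fun n => M.survival ω n s := by
  obtain ⟨m, hm⟩ := Finite.exists_max (M.survival ω N)
  set θ := M.survival ω N m
  have hθ : 0 < 1 - θ := sub_pos.mpr (hN m)
  -- With `Σ` the `n`-th partial sum, bounding the first `N` terms by 1 and the next `n` by
  -- `survival_add_le` gives `Σ ≤ N + θ Σ`.
  refine summable_of_sum_range_le (c := N / (1 - θ)) (fun n => M.survival_nonneg ω n s)
    fun n => (le_div_iff₀ hθ).mpr ?_
  have h1 : ∑ i ∈ Finset.range n, M.survival ω i s ≤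
      ∑ i ∈ Finset.range (N + n), M.survival ω i s :=
    Finset.sum_le_sum_of_subset_of_nonneg (Finset.range_subset_range.mpr (Nat.le_add_left n N))
      fun i _ _ => M.survival_nonneg ω i s
  rw [Finset.sum_range_add] at h1
  have h2 : ∑ i ∈ Finset.range N, M.survival ω i s ≤ N := by
    simpa using Finset.sum_le_sum fun i (_ : i ∈ Finset.range N) => M.survival_le_one ω i s
  have h3 : ∑ i ∈ Finset.range n, M.survival ω (N + i) s ≤
      θ * ∑ i ∈ Finset.range n, M.survival ω i s := by
    rw [Finset.mul_sum]
    exact Finset.sum_le_sum fun i _ => by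
      rw [add_comm]
      exact M.survival_add_le ω hm i s
  linarith

/-- The probability that `ω`, started in `s`, terminates after exactly `l` stages. -/
def lengthLaw : ℕ → S → ℝ
  | 0, _ => 0
  | l + 1, s => M.survival ω l s - M.survival ω (l + 1) s

theorem sum_lengthLaw (n : ℕ) (s : S) :
    ∑ l ∈ Finset.range (n + 1), M.lengthLaw ω l s = 1 - M.survival ω n s := by
  rw [Finset.sum_range_succ']
  simp only [lengthLaw, add_zero]
  rw [Finset.sum_range_sub' (fun l => M.survival ω l s)]
  rfl

/-- Summation by parts: the truncated mean length is at most a partial sum of survival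
probabilities. -/
theorem sum_mul_lengthLaw (n : ℕ) (s : S) :
    ∑ l ∈ Finset.range (n + 1), M.lengthLaw ω l s * (l : ℝ) =
      ∑ l ∈ Finset.range n, M.survival ω l s - n * M.survival ω n s := by
  induction n with
  | zero => simp [lengthLaw]
  | succ n ih =>
    rw [Finset.sum_range_succ, ih, Finset.sum_range_succ]
    simp only [lengthLaw]
    push_cast
    ring

variable [DecidableEq S]

theorem optionLaw_nonneg (l : ℕ) : ∀ s s' r, 0 ≤ M.optionLaw ω l s s' r := by
  induction l with
  | zero => intro s s' r; exact le_rfl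
  | succ l ih =>
    intro s s' r
    rw [optionLaw]
    refine Finset.sum_nonneg fun a _ => mul_nonneg (ω.pol_nonneg a s) <|
      Finset.sum_nonneg fun t _ => Finset.sum_nonneg fun ρ _ => mul_nonneg (M.p_nonneg t ρ s a) <|
      add_nonneg (mul_nonneg (ω.term_nonneg t) ?_)
        (mul_nonneg (sub_nonneg.mpr (ω.term_le_one t)) (ih _ _ _))
    split_ifs <;> norm_num

/-- Each stage adds a reward of modulus at most `B`. On the support therefore `|r| ≤ l * B`, and
finite mean length implies finite mean absolute reward. -/
theorem optionLaw_eq_zero {B : ℝ} (hB : 0 ≤ B) (hρ : ∀ ρ : M.rewards, |(ρ : ℝ)| ≤ B) (l : ℕ) :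
    ∀ s s' r, l * B < |r| → M.optionLaw ω l s s' r = 0 := by
  induction l with
  | zero => intro s s' r _; rfl
  | succ l ih =>
    intro s s' r hr
    rw [optionLaw]
    refine Finset.sum_eq_zero fun a _ => ?_
    rw [Finset.sum_eq_zero, mul_zero]
    refine fun t _ => Finset.sum_eq_zero fun ρ _ => ?_
    push_cast at hr
    have hlB : 0 ≤ l * B := by positivity
    rw [ih, if_neg]
    · ring
    · rintro ⟨-, rfl, -⟩
      have := hρ ρ
      linarith
    · have h1 := abs_sub_abs_le_abs_sub r ρ
      have := hρ ρ
      linarith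

theorem hasSum_optionLaw (l : ℕ) : ∀ s,
    HasSum (fun y : S × ℝ => M.optionLaw ω l s y.1 y.2) (M.lengthLaw ω l s) := by
  induction l with
  | zero => intro s; exact hasSum_zero
  | succ l ih =>
    intro s
    -- The length law obeys the recursion of `optionLaw` with final state and reward summed out; the
    -- termination indicator contributes only when `l = 0`.
    have hval : M.lengthLaw ω (l + 1) s = M.stageMean ω (fun t =>
        ω.term t * (if l = 0 then 1 else 0) + (1 - ω.term t) * M.lengthLaw ω l t) s := by
      cases l with
      | zero =>
        change 1 - M.stageMean ω (fun t => (1 - ω.term t) * 1) s = _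
        have h1 := M.stageMean_sub ω (fun _ => 1) (fun t => (1 - ω.term t) * 1) s
        rw [stageMean_one] at h1
        rw [← h1]
        simp [lengthLaw]
      | succ l =>
        change M.survival ω (l + 1) s - M.survival ω (l + 1 + 1) s = _
        rw [survival.eq_2, survival.eq_2, ← stageMean_sub]
        simp only [← mul_sub, l.succ_ne_zero, if_false, mul_zero, zero_add]
        rfl
    rw [hval]
    simp only [optionLaw]
    refine hasSum_sum fun a _ => HasSum.mul_left _ <| hasSum_sum fun t _ =>
      hasSum_sum fun ρ _ => HasSum.mul_left _ <| HasSum.add (HasSum.mul_left _ ?_)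
        (HasSum.mul_left _ ?_)
    · have h := hasSum_single (f := fun y : S × ℝ =>
        if t = y.1 ∧ (ρ : ℝ) = y.2 ∧ l + 1 = 1 then (1 : ℝ) else 0) (t, (ρ : ℝ)) fun y hy => by
          rw [if_neg]
          rintro ⟨h1, h2, -⟩
          exact hy (Prod.ext h1.symm h2.symm)
      simpa using h
    -- Translating the reward by `ρ` is a bijection of `ℝ`, so it does not change the sum.
    · exact (Equiv.hasSum_iff ((Equiv.refl S).prodCongr (Equiv.subRight (ρ : ℝ)))
        (f := fun y : S × ℝ => M.optionLaw ω l t y.1 y.2)).mpr (ih t)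

theorem sum_tsum_optionLaw (l : ℕ) (s : S) :
    ∑ s' : S, ∑' r : ℝ, M.optionLaw ω l s s' r = M.lengthLaw ω l s := by
  have h := M.hasSum_optionLaw ω l s
  rw [← h.tsum_eq, h.summable.tsum_prod, tsum_fintype]

theorem lengthLaw_nonneg (l : ℕ) (s : S) : 0 ≤ M.lengthLaw ω l s :=
  (M.hasSum_optionLaw ω l s).nonneg fun _ => M.optionLaw_nonneg ω l _ _ _

/-- The lengths `0, …, |S|` have total probability one minus the survival probability after `|S|`
stages. -/
theorem optionsTerminate_iff (opt : O → MDPOption S A) :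
    M.OptionsTerminate opt ↔ ∀ o s, M.survival (opt o) (Fintype.card S) s < 1 := by
  simp only [OptionsTerminate, sum_tsum_optionLaw, sum_lengthLaw, sub_pos]

/-- Integration of a function of the length against the law of an option. -/
theorem hasSum_optionLaw_mul {c : ℕ → ℝ} (hc : ∀ l, 0 ≤ c l) (s : S)
    (hsum : Summable fun l => M.lengthLaw ω l s * c l) :
    HasSum (fun x : S × ℝ × ℕ => M.optionLaw ω x.2.2 s x.1 x.2.1 * c x.2.2)
      (∑' l, M.lengthLaw ω l s * c l) := by
  have hl : ∀ l, HasSum (fun y : S × ℝ => M.optionLaw ω l s y.1 y.2 * c l)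
      (M.lengthLaw ω l s * c l) := fun l => (M.hasSum_optionLaw ω l s).mul_right _
  have hs : Summable fun z : ℕ × S × ℝ => M.optionLaw ω z.1 s z.2.1 z.2.2 * c z.1 := by
    rw [summable_prod_of_nonneg fun z => mul_nonneg (M.optionLaw_nonneg ω _ _ _ _) (hc _)]
    exact ⟨fun l => (hl l).summable, by simpa only [(hl _).tsum_eq] using hsum⟩
  have h := hs.hasSum
  rw [hs.tsum_prod] at h
  simp only [(hl _).tsum_eq] at h
  let e : S × ℝ × ℕ ≃ ℕ × S × ℝ := (Equiv.prodAssoc S ℝ ℕ).symm.trans (Equiv.prodComm (S × ℝ) ℕ)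
  exact (Equiv.hasSum_iff e
    (f := fun z : ℕ × S × ℝ => M.optionLaw ω z.1 s z.2.1 z.2.2 * c z.1)).mpr h

/-- A finite MDP with options that terminate is an SMDP. -/
theorem isSMDP_optionKernel [Nonempty S] {opt : O → MDPOption S A}
    (hopt : M.OptionsTerminate opt) : IsSMDP (M.optionKernel opt) := by
  rw [optionsTerminate_iff] at hopt
  have hsurv := fun o => M.summable_survival (opt o) (hopt o)
  have hone : ∀ s o, HasSum (fun l => M.lengthLaw (opt o) l s) 1 := fun s o => by
    rw [hasSum_iff_tendsto_nat_of_nonneg fun l => M.lengthLaw_nonneg _ l s,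
      ← tendsto_add_atTop_iff_nat 1]
    simp only [sum_lengthLaw]
    simpa using (hsurv o s).tendsto_atTop_zero.const_sub 1
  have hlen : ∀ s o, Summable fun l => M.lengthLaw (opt o) l s * (l : ℝ) := fun s o => by
    refine summable_of_sum_range_le (c := ∑' l, M.survival (opt o) l s)
      (fun l => mul_nonneg (M.lengthLaw_nonneg _ l s) l.cast_nonneg) fun n => ?_
    refine (Finset.sum_le_sum_of_subset_of_nonneg
      (Finset.range_subset_range.mpr n.le_succ) fun l _ _ =>
      mul_nonneg (M.lengthLaw_nonneg _ l s) l.cast_nonneg).trans ?_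
    rw [Nat.succ_eq_add_one, sum_mul_lengthLaw]
    have h1 := (hsurv o s).sum_le_tsum (Finset.range n)
      fun l _ => M.survival_nonneg (opt o) l s
    have h2 := mul_nonneg (n.cast_nonneg (α := ℝ)) (M.survival_nonneg (opt o) n s)
    linarith
  have hlen' : ∀ s o, Summable fun x : S × ℝ × ℕ =>
      M.optionLaw (opt o) x.2.2 s x.1 x.2.1 * (x.2.2 : ℝ) := fun s o =>
    (M.hasSum_optionLaw_mul (opt o) (fun l => l.cast_nonneg) s (hlen s o)).summable
  refine ⟨fun s o s' r l => M.optionLaw_nonneg _ _ _ _ _, fun s o => ?_, fun _ _ _ _ => rfl,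
    fun s o => ?_, hlen'⟩
  · have h := M.hasSum_optionLaw_mul (opt o) (c := fun _ => 1) (fun _ => zero_le_one) s
      (by simpa using (hone s o).summable)
    simp only [mul_one, (hone s o).tsum_eq] at h
    exact h
  · set B := ∑ ρ : M.rewards, |(ρ : ℝ)|
    have hB : 0 ≤ B := Finset.sum_nonneg fun _ _ => abs_nonneg _
    have hρ : ∀ ρ : M.rewards, |(ρ : ℝ)| ≤ B := fun ρ =>
      Finset.single_le_sum (f := fun ρ : M.rewards => |(ρ : ℝ)|) (fun _ _ => abs_nonneg _)
        (Finset.mem_univ ρ)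
    refine Summable.of_nonneg_of_le (fun x => mul_nonneg (M.optionLaw_nonneg _ _ _ _ _)
      (abs_nonneg _)) (fun x => ?_) ((hlen' s o).mul_left B)
    change M.optionLaw (opt o) x.2.2 s x.1 x.2.1 * _ ≤ _
    by_cases hx : x.2.2 * B < |x.2.1|
    · simp [M.optionLaw_eq_zero (opt o) hB hρ _ s x.1 _ hx]
    · have := mul_le_mul_of_nonneg_left (not_lt.mp hx)
        (M.optionLaw_nonneg (opt o) x.2.2 s x.1 x.2.1)
      linarith

end FiniteMDP

/-! ### The three-state example -/

/-- A primitive option stops after one stage with certainty, so the kernel is a point mass and every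
series over it has a single term. -/
theorem exampleKernel_apply (s : Fin 3) (b : Bool) (s' : Fin 3) (r : ℝ) (l : ℕ) :
    exampleKernel s b s' r l =
      if (s', r, l) = (exampleNext s b, exampleReward s b, 1) then 1 else 0 := by
  have hmem : exampleReward s b ∈ exampleMDP.rewards := by
    change _ ∈ ({0, -1, -2} : Finset ℝ)
    fin_cases s <;> cases b <;> simp [exampleReward, eq_comm]
  change exampleMDP.optionLaw (primitiveOption b) l s s' r = _
  cases l with
  | zero => simp [FiniteMDP.optionLaw]
  | succ l =>
    rw [FiniteMDP.optionLaw, Finset.sum_eq_single b, Finset.sum_eq_single (exampleNext s b),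
      Finset.sum_eq_single ⟨exampleReward s b, hmem⟩]
    · simp [primitiveOption, exampleMDP, eq_comm]
    · intro ρ _ hρ
      have : (ρ : ℝ) ≠ exampleReward s b := fun h => hρ (Subtype.ext h)
      simp [exampleMDP, this]
    · exact fun h => absurd (Finset.mem_univ _) h
    · intro t _ ht
      simp [exampleMDP, ht]
    · simp
    · intro a _ ha
      simp [primitiveOption, ha]
    · simp

theorem exampleMDP_optionsTerminate :
    exampleMDP.OptionsTerminate (primitiveOption : Bool → MDPOption (Fin 3) Bool) := by
  rw [FiniteMDP.optionsTerminate_iff]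
  intro b s
  simp [FiniteMDP.survival, FiniteMDP.stageMean, primitiveOption]

theorem isSMDP_exampleKernel : IsSMDP exampleKernel :=
  exampleMDP.isSMDP_optionKernel exampleMDP_optionsTerminate

theorem exampleKernel_trans_pos (s : Fin 3) (b : Bool) :
    0 < exampleKernel.trans s b (exampleNext s b) := by
  have h : HasSum (fun y : ℝ × ℕ => exampleKernel s b (exampleNext s b) y.1 y.2)
      (exampleKernel s b (exampleNext s b) (exampleReward s b) 1) :=
    hasSum_single (exampleReward s b, 1) fun y hy => by
      rw [exampleKernel_apply, if_neg]
      exact fun h => hy (Prod.ext_iff.mp h).2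
  rw [SMDPKernel.trans, h.tsum_eq, exampleKernel_apply]
  simp

theorem exampleKernel_optimalityEquation_iff (g : ℝ) (q : Fin 3 × Bool → ℝ) :
    exampleKernel.OptimalityEquation g q ↔ ∀ s b, q (s, b) = exampleReward s b - g +
      max (q (exampleNext s b, false)) (q (exampleNext s b, true)) := by
  refine forall_congr' fun s => forall_congr' fun b => ?_
  rw [tsum_eq_single (exampleNext s b, exampleReward s b, 1) fun x hx => by
    rw [exampleKernel_apply, if_neg hx, zero_mul]]
  have h : (Finset.univ.sup' Finset.univ_nonempty fun b' => q (exampleNext s b, b')) =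
      max (q (exampleNext s b, false)) (q (exampleNext s b, true)) := by
    refine le_antisymm (Finset.sup'_le _ _ fun b' _ => by cases b' <;> simp) (max_le ?_ ?_)
    · exact Finset.le_sup' (fun b' => q (exampleNext s b, b')) (Finset.mem_univ false)
    · exact Finset.le_sup' (fun b' => q (exampleNext s b, b')) (Finset.mem_univ true)
  rw [h, exampleKernel_apply]
  simp

/-- Always playing `dashed` runs through the cycle `0 → 1 → 2 → 0`, so `s' - s` modulo 3 steps lead
from `s` to `s'`. -/
theorem exampleKernel_isCommunicatingSet : exampleKernel.IsCommunicatingSet Set.univ := by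
  set π : StationaryPolicy (Fin 3) Bool := StationaryPolicy.ofFun fun _ => true
  have hpos : ∀ s, 0 < exampleKernel.policyMatrix π s (exampleNext s true) := fun s => by
    simp only [SMDPKernel.policyMatrix, Matrix.of_apply, π]
    rw [StationaryPolicy.sum_ofFun_mul (fun _ => true) s
      fun o => exampleKernel.trans s o (exampleNext s true)]
    exact exampleKernel_trans_pos s true
  have hpow : ∀ (n : ℕ) s,
      0 < (exampleKernel.policyMatrix π ^ n) s ((fun t => exampleNext t true)^[n] s) := by
    intro n
    induction n with
    | zero => intro s; simp
    | succ n ih =>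
      intro s
      rw [Function.iterate_succ_apply']
      have h := Matrix.mul_le_pow_add_apply (isSMDP_exampleKernel.policyMatrix_nonneg π) n 1 s
        ((fun t => exampleNext t true)^[n] s)
        (exampleNext ((fun t => exampleNext t true)^[n] s) true)
      rw [pow_one] at h
      exact (mul_pos (ih s) (hpos _)).trans_le h
  have hreach : ∀ s s' : Fin 3,
      (fun t => exampleNext t true)^[(s' - s : Fin 3).val] s = s' := by decide
  exact ⟨π, fun s _ s' _ => ⟨_, by simpa only [hreach] using hpow (s' - s : Fin 3).val s⟩⟩

theorem SMDPKernel.IsCommunicatingSet.weaklyCommunicating {S O : Type*} [Fintype S]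
    [DecidableEq S] [Nonempty S] [Fintype O] {K : SMDPKernel S O}
    (h : K.IsCommunicatingSet Set.univ) : K.WeaklyCommunicating :=
  ⟨Set.univ, Set.univ_nonempty, fun _ _ _ _ _ => Set.mem_univ _, h,
    fun s hs => absurd (Set.mem_univ s) hs⟩

theorem isAdmissibleFunctional_sum {ι : Type*} [Fintype ι] [Nonempty ι] :
    IsAdmissibleFunctional fun q : ι → ℝ => ∑ x, q x where
  lipschitz := by
    refine ⟨Fintype.card ι, LipschitzWith.of_dist_le_mul fun p q => ?_⟩
    rw [Real.dist_eq, ← Finset.sum_sub_distrib]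
    refine (Finset.abs_sum_le_sum_abs _ _).trans ?_
    have h := Finset.sum_le_card_nsmul Finset.univ (fun x => |p x - q x|) (dist p q)
      fun x _ => dist_le_pi_dist p q x
    simpa using h
  shift := ⟨Fintype.card ι, by exact_mod_cast Fintype.card_pos, by simp, fun x c => by
    simp [Finset.sum_add_distrib, mul_comm]⟩
  homogeneous c x := by simp [Finset.mul_sum]

/-- The solution of the optimality equation of the example with state values `(a, 0, b) + c`. -/
def exampleSolution (a b c : ℝ) : Fin 3 × Bool → ℝ
  | (0, false) => a + c
  | (0, true) => -2 + c
  | (1, false) => c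
  | (1, true) => b + c
  | (2, false) => -1 + c
  | (2, true) => a + c

/-- In `Fin 3` numbering, up to the common shift `c`: `-2 ≤ a` makes staying optimal in state 0, `a
≤ 0` makes staying optimal in state 1, and `b` is the better of paying 1 to reach state 1 and going
free to state 0. -/
theorem exampleSolution_optimalityEquation {a b : ℝ} (c : ℝ) (ha : -2 ≤ a) (ha' : a ≤ 0)
    (hb : b = max (-1) a) :
    exampleKernel.OptimalityEquation 0 (exampleSolution a b c) := by
  have hb' : b ≤ 0 := hb ▸ max_le (by norm_num) ha'
  have h0 : max (a + c) (-2 + c) = a + c := max_eq_left (by linarith)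
  have h1 : max c (b + c) = c := max_eq_left (by linarith)
  have h2 : max (-1 + c) (a + c) = b + c := by rw [hb, max_add_add_right]
  rw [exampleKernel_optimalityEquation_iff]
  intro s b'
  fin_cases s <;> cases b' <;> simp [exampleSolution, exampleNext, exampleReward, h0, h1, h2]

theorem not_convex_exampleKernel_solutionSet :
    ¬ Convex ℝ (exampleKernel.solutionSet (fun q => ∑ x, q x) 0) := by
  intro hconv
  -- The entries sum to `2a + b - 3 + 6c`, so the condition on `c` is the normalization `f(q) = 0`.
  have hmem : ∀ a b c : ℝ, -2 ≤ a → a ≤ 0 → b = max (-1) a → 6 * c = 3 - 2 * a - b →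
      exampleSolution a b c ∈ exampleKernel.solutionSet (fun q => ∑ x, q x) 0 :=
    fun a b c ha ha' hb hc => by
      refine ⟨⟨0, exampleSolution_optimalityEquation c ha ha' hb⟩, ?_⟩
      simp only [Fintype.sum_prod_type, Fin.sum_univ_three, Fintype.sum_bool, exampleSolution]
      linarith
  -- The values `a = -2` and `a = 0` lie on either side of the kink of `max (-1) a` at `a = -1`.
  have hp := hmem (-2) (-1) (4 / 3) le_rfl (by norm_num) (by norm_num) (by norm_num)
  have hq := hmem 0 0 (1 / 2) (by norm_num) le_rfl (by norm_num) (by norm_num)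
  obtain ⟨⟨g, hg⟩, -⟩ := hconv hp hq (a := 1 / 2) (b := 1 / 2) (by norm_num) (by norm_num)
    (by norm_num)
  rw [exampleKernel_optimalityEquation_iff] at hg
  -- At the midpoint, staying in state 1 forces `g = 0`; `dashed` there then requires `b = max (-1)
  -- (-1) = -1`, but averaging gives `b = -1/2`.
  have h1 := hg 1 false
  have h2 := hg 1 true
  simp only [exampleNext, exampleReward, exampleSolution, Pi.add_apply, Pi.smul_apply,
    smul_eq_mul] at h1 h2
  norm_num at h1 h2
  linarith

end

theorem mainTheorem5 :
    -- semi-Markov decision processes in general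
    (∀ (S O : Type*) [Fintype S] [DecidableEq S] [Nonempty S] [Fintype O] [Nonempty O]
        (K : SMDPKernel S O) (f : (S × O → ℝ) → ℝ),
      IsSMDP K → K.WeaklyCommunicating → IsAdmissibleFunctional f →
      ∃ rStar : ℝ, K.IsOptimalRate rStar ∧
        (K.solutionSet f rStar).Nonempty ∧
        IsClosed (K.solutionSet f rStar) ∧
        Bornology.IsBounded (K.solutionSet f rStar) ∧
        IsConnected (K.solutionSet f rStar)) ∧
    -- those that result from a finite MDP and a finite set of options
    (∀ (S A O : Type*) [Fintype S] [DecidableEq S] [Nonempty S] [Fintype A]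
        [Fintype O] [Nonempty O]
        (M : FiniteMDP S A) (opt : O → MDPOption S A) (f : (S × O → ℝ) → ℝ),
      M.OptionsTerminate opt → (M.optionKernel opt).WeaklyCommunicating →
      IsAdmissibleFunctional f →
      ∃ rStar : ℝ, (M.optionKernel opt).IsOptimalRate rStar ∧
        ((M.optionKernel opt).solutionSet f rStar).Nonempty ∧
        IsClosed ((M.optionKernel opt).solutionSet f rStar) ∧
        Bornology.IsBounded ((M.optionKernel opt).solutionSet f rStar) ∧
        IsConnected ((M.optionKernel opt).solutionSet f rStar)) ∧
    -- the solution set need not be convex: the explicit three-state MDP with `f(q) = ∑ q(s, a)`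
    (IsSMDP exampleKernel ∧
      exampleMDP.OptionsTerminate (primitiveOption : Bool → _) ∧
      exampleKernel.IsCommunicatingSet Set.univ ∧
      exampleKernel.WeaklyCommunicating ∧
      IsAdmissibleFunctional (fun q : Fin 3 × Bool → ℝ => ∑ x, q x) ∧
      exampleKernel.IsOptimalRate 0 ∧
      ¬ Convex ℝ (exampleKernel.solutionSet (fun q => ∑ x, q x) 0)) := by
  refine ⟨fun S O _ _ _ _ _ K f hK hwc hf => hK.exists_optimalRate_solutionSet hwc hf,
    fun S A O _ _ _ _ _ _ M opt f hopt hwc hf =>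
      (M.isSMDP_optionKernel hopt).exists_optimalRate_solutionSet hwc hf,
    isSMDP_exampleKernel, exampleMDP_optionsTerminate, exampleKernel_isCommunicatingSet,
    exampleKernel_isCommunicatingSet.weaklyCommunicating, isAdmissibleFunctional_sum,
    -- Any solution with rate 0 certifies that the optimal rate is 0; here `a = b = c = 0`.
    isSMDP_exampleKernel.isOptimalRate (exampleSolution_optimalityEquation (a := 0) (b := 0) 0
      (by norm_num) le_rfl (by norm_num)), not_convex_exampleKernel_solutionSet⟩
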